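/- Let $q$ be a power of a prime $p$, and let $n\equiv 1\pmod 4$ be a prime with $\frac{n-1}{4}\equiv 0\pmod p$. Write $n=u^2+4v^2$ with integers $u\equiv 1\pmod 4$ and $v$. Fix a generator $g$ of $(\mathbb{Z}/n)^*$, let $C_i=g^i\langle g^4\rangle$ be the cyclotomic classes of order four (indices modulo 4), and let $\eta$ be a primitive $n$-th root of unity in an extension field of $\mathrm{GF}(q)$. Put $$\Omega_i(x)=\prod_{j\in C_i}(x-\eta^j),\qquad \Lambda(x)=\sum_{i\in C_0\cup C_1}x^i,\qquad \Gamma(x)=\sum_{i\in C_1\cup C_2}x^i .$$ Let $\lambda^\infty=(\lambda_i)_{i\ge 0}$ be the sequence over $\mathrm{GF}(q)$ of period $n$ with $\lambda_i=1$ if $i \bmod n\in C_0\cup C_1$ and $\lambda_i=0$ otherwise. Let $\mathbb{L}_\lambda$ be its linear span (the least length of a linear feedback shift register generating it) and $m_\lambda(x)$ its minimal polynomial (the feedback polynomial of least degree, scaled to be monic). Let $\mathcal{C}_\lambda$ be the cyclic code of length $n$ over $\mathrm{GF}(q)$ generated by $(x^n-1)/\gcd(\Lambda(x),x^n-1)$.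 In all cases below, $m_\lambda(x)$ is the generator polynomial of $\mathcal{C}_\lambda$. 1. Let $n\equiv 1\pmod 8$ (so $v$ is even). (a) If $\frac v2\not\equiv 0\pmod p$, then $\mathbb{L}_\lambda=n-1$, $m_\lambda(x)=\frac{x^n-1}{x-1}$, and $\mathcal{C}_\lambda$ is an $[n,1,n]$ code. (b) If $\frac v2\equiv 0\pmod p$ and $q \bmod n\in C_0$, then $\mathbb{L}_\lambda=\frac{n-1}{2}$, $\Lambda(\eta),\Gamma(\eta)\in\{0,-1\}$, and $$m_\lambda(x)=\begin{cases}\Omega_2(x)\Omega_3(x)&\text{if }\Lambda(\eta)=0,\ \Gamma(\eta)=0,\\ \Omega_1(x)\Omega_2(x)&\text{if }\Lambda(\eta)=0,\ \Gamma(\eta)=-1,\\ \Omega_0(x)\Omega_3(x)&\text{if }\Lambda(\eta)=-1,\ \Gamma(\eta)=0,\\ \Omega_0(x)\Omega_1(x)&\text{if }\Lambda(\eta)=-1,\ \Gamma(\eta)=-1.\end{cases}$$ The code $\mathcal{C}_\lambda$ is a duadic $[n,\frac{n+1}{2},d]$ code, and the minimum weight $d_{odd}$ of its odd-like codewords (those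 whose coordinates have nonzero sum) satisfies $d_{odd}\ge\sqrt n$. Here duadic means that the generator polynomial is $\prod_{j\in S_1}(x-\eta^j)$, where $(\mathbb{Z}/n)\setminus\{0\}$ is the disjoint union of two sets $S_1,S_2$, each closed under multiplication by $q$, that are interchanged by multiplication by some unit of $\mathbb{Z}/n$. 2. Let $n\equiv 5\pmod 8$. (a) If $\frac{u^2+3}{4}\not\equiv 0\pmod p$, then $\mathbb{L}_\lambda=n-1$, $m_\lambda(x)=\frac{x^n-1}{x-1}$, and $\mathcal{C}_\lambda$ is an $[n,1,n]$ code. (b) If $\frac{u^2+3}{4}\equiv 0\pmod p$ and $q\bmod n\in C_0$, then $\mathbb{L}_\lambda=\frac{3(n-1)}{4}$, at least one of $\Lambda(\eta)=0$, $\Lambda(\eta)=-1$, $\Gamma(\eta)=0$, $\Gamma(\eta)=-1$ holds, and $$m_\lambda(x)=\begin{cases}\frac{x^n-1}{(x-1)\Omega_0(x)}&\text{if }\Lambda(\eta)=0,\\ \frac{x^n-1}{(x-1)\Omega_2(x)}&\text{if }\Lambda(\eta)=-1,\\ \frac{x^n-1}{(x-1)\Omega_1(x)}&\text{if }\Gamma(\eta)=0,\\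 \frac{x^n-1}{(x-1)\Omega_3(x)}&\text{if }\Gamma(\eta)=-1.\end{cases}$$ The code $\mathcal{C}_\lambda$ is an $[n,\frac{n+3}{4},d]$ code. If moreover $\mathrm{ord}_n(q)=\frac{n-1}{4}$, then, with $r=q^{(n-1)/4}$ and $N=\frac{r-1}{n}$, $$d\ \ge\ \frac{(q-1)(r-1)-1}{qN}-\frac{q-1}{q}\cdot\frac{(N-1)\sqrt{r}}{N},$$ and also $$d\ \ge\ \left\lfloor\frac{(q-1)(r-1)-1}{qN}-\frac{q-1}{q}\left\lfloor\frac{(N-1)\sqrt{r}}{N}\right\rfloor\right\rfloor .$$ -/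

import Mathlib

open Polynomial

namespace CycCode

noncomputable section

/-! ### Periodic sequences: linear span and minimal polynomial -/

/-- `c = c₀ + c₁ x + ⋯ + c_ℓ x^ℓ` with `c₀ = 1` is the feedback polynomial of a linear feedback
shift register of length `ℓ` generating `s`: `-s_i = c₁ s_{i-1} + ⋯ + c_ℓ s_{i-ℓ}` for all
`i ≥ ℓ`. -/
def IsFeedbackPoly {F : Type*} [Field F] (s : ℕ → F) (ℓ : ℕ) (c : F[X]) : Prop :=
  c.coeff 0 = 1 ∧ c.natDegree ≤ ℓ ∧
    ∀ i, ℓ ≤ i → -s i = ∑ j ∈ Finset.Icc 1 ℓ, c.coeff j * s (i - j)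

/-- The linear span of a semi-infinite sequence: the least length of a register generating it,
and `⊤` if there is none. (A register of length `0` generates the zero sequence only, so that
the span is `0` exactly for the zero sequence.) -/
def linearSpan {F : Type*} [Field F] (s : ℕ → F) : ℕ∞ :=
  sInf {x : ℕ∞ | ∃ ℓ : ℕ, (∃ c : F[X], IsFeedbackPoly s ℓ c) ∧ x = (ℓ : ℕ∞)}

/-- A characteristic polynomial is a feedback polynomial (of constant term `1`) of some register
generating the sequence. -/
def IsCharPoly {F : Type*} [Field F] (s : ℕ → F) (c : F[X]) : Prop :=
  ∃ ℓ : ℕ, IsFeedbackPoly s ℓ c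

/-- `m` is the minimal polynomial of `s`, normalised to be monic: `m` is monic, and dividing it by
its constant term gives a characteristic polynomial of smallest degree. -/
def IsMinimalPoly {F : Type*} [Field F] (s : ℕ → F) (m : F[X]) : Prop :=
  m.Monic ∧ IsCharPoly s (C (m.coeff 0)⁻¹ * m) ∧
    ∀ c : F[X], IsCharPoly s c → m.natDegree ≤ c.natDegree

/-! ### Cyclic codes -/

/-- The polynomial `c₀ + c₁ x + ⋯ + c_{n-1} x^{n-1}` of a vector of length `n`. -/
def wordPoly {F : Type*} [Field F] (n : ℕ) : (Fin n → F) →ₗ[F] F[X] :=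
  ∑ i : Fin n, (monomial (i : ℕ)).comp (LinearMap.proj i)

/-- The cyclic code of length `n` given by the ideal generated by `g` in `F[x]/(x^n-1)`, that is, by
the ideal `(g, x^n-1)` of `F[x]`. -/
def cyclicCode {F : Type*} [Field F] (n : ℕ) (g : F[X]) : Submodule F (Fin n → F) :=
  ((Ideal.span {g, (X : F[X]) ^ n - 1}).restrictScalars F).comap (wordPoly n)

/-- `g` is the generator polynomial of the code `D`: it is the monic divisor of `x^n-1` that
generates the ideal of `D`. -/
def IsGeneratorPoly {F : Type*} [Field F] {n : ℕ} (D : Submodule F (Fin n → F)) (g : F[X]) :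
    Prop :=
  g.Monic ∧ g ∣ (X : F[X]) ^ n - 1 ∧ D = cyclicCode n g

open Classical in
/-- The code of length `n` defined by the sequence `s` of period `n`: the cyclic code generated by
`(x^n-1)/gcd(Λ(x), x^n-1)`, where `Λ(x) = ∑_{i<n} s_i x^i`. -/
def seqCode {F : Type*} [Field F] (n : ℕ) (s : ℕ → F) : Submodule F (Fin n → F) :=
  cyclicCode n (((X : F[X]) ^ n - 1) /
    EuclideanDomain.gcd (∑ i ∈ Finset.range n, C (s i) * X ^ i) ((X : F[X]) ^ n - 1))

open Classical in
/-- `D` is a linear `[n, k, d]` code: dimension `k` and minimum nonzero Hamming weight `d`. -/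
def HasParameters {F : Type*} [Field F] {n : ℕ} (D : Submodule F (Fin n → F)) (k d : ℕ) : Prop :=
  Module.finrank F D = k ∧ IsLeast {w : ℕ | ∃ c ∈ D, c ≠ 0 ∧ hammingNorm c = w} d

open Classical in
/-- `d` is the minimum weight of the odd-like codewords (those with nonzero coordinate sum). -/
def IsMinOddLikeWeight {F : Type*} [Field F] {n : ℕ} (D : Submodule F (Fin n → F)) (d : ℕ) :
    Prop :=
  IsLeast {w : ℕ | ∃ c ∈ D, ∑ i, c i ≠ 0 ∧ hammingNorm c = w} d

/-! ### Cyclotomic classes of order four -/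

open Classical in
/-- The cyclotomic class `g^i ⟨g^4⟩` of order four in `ℤ/n`, for a generator `g` of the unit
group. -/
def cycClass {n : ℕ} [NeZero n] (g : (ZMod n)ˣ) (i : ℕ) : Finset (ZMod n) :=
  Finset.univ.filter fun x => ∃ y ∈ Subgroup.zpowers (g ^ 4), x = ((g ^ i * y : (ZMod n)ˣ) : ZMod n)

/-- The sequence equal to `1` where `i mod n ∈ C₀ ∪ C₁` and to `0` elsewhere. -/
def cycSeq (F : Type*) [Field F] {n : ℕ} [NeZero n] (g : (ZMod n)ˣ) (i : ℕ) : F :=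
  if (i : ZMod n) ∈ cycClass g 0 ∪ cycClass g 1 then 1 else 0

/-- `∑_{i ∈ S} x^i`, the exponents being the representatives in `{0, …, n-1}`. -/
def setPoly (F : Type*) [Field F] {n : ℕ} (S : Finset (ZMod n)) : F[X] :=
  ∑ i ∈ S, X ^ i.val

/-- `Λ(x) = ∑_{i ∈ C₀ ∪ C₁} x^i`. -/
def Lam (F : Type*) [Field F] {n : ℕ} [NeZero n] (g : (ZMod n)ˣ) : F[X] :=
  setPoly F (cycClass g 0 ∪ cycClass g 1)

/-- `Γ(x) = ∑_{i ∈ C₁ ∪ C₂} x^i`. -/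
def Gam (F : Type*) [Field F] {n : ℕ} [NeZero n] (g : (ZMod n)ˣ) : F[X] :=
  setPoly F (cycClass g 1 ∪ cycClass g 2)

/-- `∏_{j ∈ S} (x - η^j)`. -/
def rootPoly {K : Type*} [Field K] {n : ℕ} (η : K) (S : Finset (ZMod n)) : K[X] :=
  ∏ j ∈ S, (X - C (η ^ j.val))

/-- `Ω_i(x) = ∏_{j ∈ C_i} (x - η^j)`. -/
def Om {K : Type*} [Field K] {n : ℕ} [NeZero n] (η : K) (g : (ZMod n)ˣ) (i : ℕ) : K[X] :=
  rootPoly η (cycClass g i)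

/-- `D` is an (odd-like) duadic code: for a splitting of `ℤ/n ∖ {0}` into two sets `S₁`, `S₂`,
unions of `q`-cyclotomic cosets interchanged by a multiplier `a`, the generator polynomial of `D`
is `∏_{j ∈ S₁} (x - η^j)`; `η` is a primitive `n`-th root of unity and `q = |F|`. -/
def IsDuadic {F K : Type*} [Field F] [Fintype F] [Field K] [Algebra F K] {n : ℕ} [NeZero n]
    (η : K) (D : Submodule F (Fin n → F)) : Prop :=
  ∃ S₁ S₂ : Finset (ZMod n), Disjoint S₁ S₂ ∧ S₁ ∪ S₂ = Finset.univ.erase 0 ∧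
    (∀ x ∈ S₁, (Fintype.card F : ZMod n) * x ∈ S₁) ∧
    (∀ x ∈ S₂, (Fintype.card F : ZMod n) * x ∈ S₂) ∧
    (∃ a : (ZMod n)ˣ, S₁.image (fun x => (a : ZMod n) * x) = S₂ ∧
      S₂.image (fun x => (a : ZMod n) * x) = S₁) ∧
    ∃ f : F[X], IsGeneratorPoly D f ∧ f.map (algebraMap F K) = rootPoly η S₁

end

end CycCode

open CycCode

/-! The generating function of a sequence of period n is Λ(x)/(1-x^n). The monic denominator m of
the reduced fraction divides every feedback polynomial and is one itself up to a scalar, so its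
degree is the linear span; the gcd of Λ and x^n-1 is the cofactor of m up to a unit, so m generates
the code (`IsReducedFraction`). The roots of m in K are the η^j with Λ(η^j) ≠ 0
(`IsReducedFraction.map_eq_rootPoly`).

Let η_i be the Gaussian periods of order four. On C_i the value Λ(η^j) is η_i + η_{i+1}, while Λ(1)
= (n-1)/2 vanishes in F. Since the periods sum to -1, the four values are A, B, -1-A, -1-B with A =
Λ(η) and B = Γ(η), and all depends on whether A²+A and B²+B vanish. Quartic Gauss and Jacobi sums
give these over ℂ (`quartic_periods_complex`), and divisibility by the cyclotomic polynomial carries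
the relations to K. There n = 1, so R = η_0-η_1+η_2-η_3 has R² = 1. For n ≡ 1 mod 8, A²+A and B²+B
are ±(v/2)R: both vanish or neither does. For n ≡ 5 mod 8 they sum to -1 and four times their
product is (u²+3)/4: at most one vanishes.

When both vanish, the code is duadic with multiplier g², and the square root bound follows by
convolving a word with its image under the multiplier (`le_sq_card_support`). The last bounds come
from second moments (`weight_bound`): in the zero-sum subcode any two coordinates are jointly
equidistributed, so the number of occurrences of a symbol has known mean and mean square over all
words. The n distinct shifts of one word share the same count, and Cauchy–Schwarz on the remaining
words limits how far that count can deviate. -/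

namespace CycCode

/-! ### Cyclotomic classes of order four via a quartic character -/

section Cyclotomy

variable {n : ℕ} [Fact n.Prime]

theorem exists_quartic_mulChar (hn4 : n % 4 = 1) {g : (ZMod n)ˣ}
    (hg : ∀ x : (ZMod n)ˣ, x ∈ Subgroup.zpowers g) :
    ∃ χ : MulChar (ZMod n) ℂ, χ (g : ZMod n) = Complex.I := by
  have hI : (Units.mk0 Complex.I Complex.I_ne_zero) ∈
      rootsOfUnity (Fintype.card (ZMod n)ˣ) ℂ := by
    rw [mem_rootsOfUnity', ZMod.card_units_eq_totient, Nat.totient_prime Fact.out]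
    obtain ⟨k, hk⟩ : 4 ∣ n - 1 := by omega
    rw [hk, pow_mul]
    simp
  exact ⟨MulChar.ofRootOfUnity hI hg, by simp [MulChar.ofRootOfUnity_spec]⟩

theorem I_pow_eq_I_pow_iff {i j : ℕ} : Complex.I ^ i = Complex.I ^ j ↔ i % 4 = j % 4 := by
  have h : orderOf Complex.I = 4 := Complex.isPrimitiveRoot_I.eq_orderOf.symm
  rw [← pow_mod_orderOf Complex.I i, ← pow_mod_orderOf Complex.I j, h]
  exact ⟨fun hij => Complex.isPrimitiveRoot_I.pow_inj (Nat.mod_lt _ (by norm_num))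
    (Nat.mod_lt _ (by norm_num)) hij, fun hij => by rw [hij]⟩

theorem exists_nat_pow_eq {g : (ZMod n)ˣ} (hg : ∀ x : (ZMod n)ˣ, x ∈ Subgroup.zpowers g)
    (x : (ZMod n)ˣ) : ∃ k : ℕ, g ^ k = x :=
  Submonoid.mem_powers_iff _ _ |>.1 (mem_powers_iff_mem_zpowers.2 (hg x))

/-- Since i has order exactly four, the exponent of g modulo 4 can be read off from χ. Facts about
classes thereby become identities between powers of i. -/
theorem mem_cycClass_iff {g : (ZMod n)ˣ} (hg : ∀ x : (ZMod n)ˣ, x ∈ Subgroup.zpowers g)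
    {χ : MulChar (ZMod n) ℂ} (hχ : χ (g : ZMod n) = Complex.I) {x : ZMod n} {i : ℕ} :
    x ∈ cycClass g i ↔ χ x = Complex.I ^ i := by
  simp only [cycClass, Finset.mem_filter, Finset.mem_univ, true_and]
  constructor
  · rintro ⟨y, hy, rfl⟩
    obtain ⟨k, rfl⟩ := Submonoid.mem_powers_iff _ _ |>.1 (mem_powers_iff_mem_zpowers.2 hy)
    push_cast
    simp [hχ]
  · intro h
    have hx : IsUnit x := by
      by_contra hx
      rw [χ.map_nonunit hx] at h
      exact pow_ne_zero _ Complex.I_ne_zero h.symm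
    obtain ⟨k, hk⟩ := exists_nat_pow_eq hg hx.unit
    have hxk : x = ((g ^ k : (ZMod n)ˣ) : ZMod n) := by rw [hk]; rfl
    have hk4 : k % 4 = i % 4 := by
      rw [hxk] at h
      push_cast at h
      rwa [map_pow, hχ, I_pow_eq_I_pow_iff] at h
    refine ⟨g ^ ((k : ℤ) - i), ?_, ?_⟩
    · obtain ⟨t, ht⟩ : (4 : ℤ) ∣ (k : ℤ) - i := by omega
      rw [ht, zpow_mul]
      exact Subgroup.zpow_mem _ (by exact_mod_cast Subgroup.mem_zpowers _) _
    · rw [hxk, ← zpow_natCast g i, ← zpow_add]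
      simp

variable {g : (ZMod n)ˣ} (hn4 : n % 4 = 1) (hg : ∀ x : (ZMod n)ˣ, x ∈ Subgroup.zpowers g)

theorem zero_notMem_cycClass (i : ℕ) : (0 : ZMod n) ∉ cycClass g i := by
  simp only [cycClass, Finset.mem_filter, Finset.mem_univ, true_and, not_exists, not_and]
  intro y _ h
  exact Units.ne_zero _ h.symm

include hn4 hg

theorem exists_mem_cycClass {x : ZMod n} (hx : x ≠ 0) : ∃ i < 4, x ∈ cycClass g i := by
  obtain ⟨χ, hχ⟩ := exists_quartic_mulChar hn4 hg
  obtain ⟨k, hk⟩ := exists_nat_pow_eq hg (Units.mk0 x hx)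
  refine ⟨k % 4, Nat.mod_lt _ (by norm_num), ?_⟩
  rw [mem_cycClass_iff hg hχ]
  have : x = (g : ZMod n) ^ k := by
    have := congrArg (Units.val) hk
    simpa using this.symm
  rw [this, map_pow, hχ, I_pow_eq_I_pow_iff]
  simp

theorem mod_eq_of_mem_cycClass {x : ZMod n} {i j : ℕ} (hi : x ∈ cycClass g i)
    (hj : x ∈ cycClass g j) : i % 4 = j % 4 := by
  obtain ⟨χ, hχ⟩ := exists_quartic_mulChar hn4 hg
  rw [mem_cycClass_iff hg hχ] at hi hj
  rw [← I_pow_eq_I_pow_iff, ← hi, ← hj]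

theorem mul_mem_cycClass {x y : ZMod n} {i j : ℕ} (hi : x ∈ cycClass g i)
    (hj : y ∈ cycClass g j) : x * y ∈ cycClass g (i + j) := by
  obtain ⟨χ, hχ⟩ := exists_quartic_mulChar hn4 hg
  rw [mem_cycClass_iff hg hχ] at hi hj ⊢
  rw [map_mul, hi, hj, pow_add]

theorem cycClass_congr {i j : ℕ} (h : i % 4 = j % 4) : cycClass g i = cycClass g j := by
  obtain ⟨χ, hχ⟩ := exists_quartic_mulChar hn4 hg
  ext x
  rw [mem_cycClass_iff hg hχ, mem_cycClass_iff hg hχ, I_pow_eq_I_pow_iff.2 h]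

theorem sum_cycClass_mul {M : Type*} [AddCommMonoid M] (f : ZMod n → M) {j : ZMod n} {i k : ℕ}
    (hj : j ∈ cycClass g i) :
    ∑ x ∈ cycClass g k, f (j * x) = ∑ x ∈ cycClass g (i + k), f x := by
  obtain ⟨χ, hχ⟩ := exists_quartic_mulChar hn4 hg
  have hj0 : j ≠ 0 := fun h => zero_notMem_cycClass i (h ▸ hj)
  refine Finset.sum_bij (fun x _ => j * x) (fun x hx => mul_mem_cycClass hn4 hg hj hx)
    (fun x _ y _ h => mul_left_cancel₀ hj0 h) (fun y hy => ⟨j⁻¹ * y, ?_, ?_⟩) (fun _ _ => rfl)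
  · rw [mem_cycClass_iff hg hχ] at *
    have h1 : χ j * χ (j⁻¹ * y) = χ j * Complex.I ^ k := by
      rw [← map_mul, mul_inv_cancel_left₀ hj0, hy, hj, pow_add]
    exact mul_left_cancel₀ (by rw [hj]; exact pow_ne_zero _ Complex.I_ne_zero) h1
  · exact mul_inv_cancel_left₀ hj0 y

theorem sum_eq_sum_cycClass {M : Type*} [AddCommMonoid M] (f : ZMod n → M) :
    ∑ x, f x = f 0 + (∑ x ∈ cycClass g 0, f x + ∑ x ∈ cycClass g 1, f x +
      ∑ x ∈ cycClass g 2, f x + ∑ x ∈ cycClass g 3, f x) := by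
  classical
  have hmem : ∀ (x : ZMod n) (i j : ℕ), i < 4 → j < 4 → x ∈ cycClass g i →
      (x ∈ cycClass g j ↔ i = j) := by
    intro x i j hi hj hx
    refine ⟨fun h => ?_, fun h => h ▸ hx⟩
    have := mod_eq_of_mem_cycClass hn4 hg hx h
    omega
  have h0 : f 0 = ∑ x, if x = 0 then f x else 0 := by simp
  have hc : ∀ i, ∑ x ∈ cycClass g i, f x = ∑ x, if x ∈ cycClass g i then f x else 0 := by
    intro i; simp
  rw [h0, hc, hc, hc, hc, ← Finset.sum_add_distrib, ← Finset.sum_add_distrib,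
    ← Finset.sum_add_distrib, ← Finset.sum_add_distrib]
  refine Finset.sum_congr rfl fun x _ => ?_
  by_cases hx : x = 0
  · subst hx
    simp [zero_notMem_cycClass]
  · obtain ⟨i, hi, hxi⟩ := exists_mem_cycClass hn4 hg hx
    rw [if_neg hx]
    simp only [hmem x i 0 hi (by norm_num) hxi, hmem x i 1 hi (by norm_num) hxi,
      hmem x i 2 hi (by norm_num) hxi, hmem x i 3 hi (by norm_num) hxi]
    interval_cases i <;> simp

theorem card_cycClass (i : ℕ) : (cycClass g i).card = (n - 1) / 4 := by
  obtain ⟨χ, hχ⟩ := exists_quartic_mulChar hn4 hg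
  have key : ∀ i, (cycClass g i).card = (cycClass g 0).card := by
    intro i
    have hgi : ((g ^ i : (ZMod n)ˣ) : ZMod n) ∈ cycClass g i := by
      rw [mem_cycClass_iff hg hχ]; push_cast; rw [map_pow, hχ]
    have := sum_cycClass_mul hn4 hg (fun _ => 1) (k := 0) hgi
    simpa using this.symm
  have := sum_eq_sum_cycClass hn4 hg (fun _ => 1)
  simp only [Finset.sum_const, smul_eq_mul, mul_one, Finset.card_univ, ZMod.card, key 1, key 2,
    key 3] at this
  rw [key]
  omega

end Cyclotomy

/-- The Gaussian period `∑_{x ∈ C_i} η^x` of order four. -/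
noncomputable def period {K : Type*} [Field K] {n : ℕ} [NeZero n] (η : K) (g : (ZMod n)ˣ)
    (i : ℕ) : K :=
  ∑ x ∈ cycClass g i, η ^ x.val

/-- The integral polynomial `∑_{x ∈ C_i} X^x`. -/
noncomputable def periodPoly {n : ℕ} [NeZero n] (g : (ZMod n)ˣ) (i : ℕ) : ℤ[X] :=
  ∑ x ∈ cycClass g i, X ^ x.val

theorem aeval_periodPoly {K : Type*} [Field K] {n : ℕ} [NeZero n] (η : K) (g : (ZMod n)ˣ)
    (i : ℕ) : aeval η (periodPoly g i) = period η g i := by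
  simp [periodPoly, period]

/-! ### Quartic Gauss sums, Jacobi sums and the relations between the periods -/

section Gauss

variable {n : ℕ} [Fact n.Prime] {g : (ZMod n)ˣ} (hn4 : n % 4 = 1)
  (hg : ∀ x : (ZMod n)ˣ, x ∈ Subgroup.zpowers g)

/-- Uniqueness of a prime as x²+4y². The prime divides (av-cu)(av+cu) up to sign, and the product
formula n² = (au+4cw)² + 4(aw-cu)² leaves no room for a nonzero multiple of n in the second square.
-/
theorem eq_or_eq_neg_of_sq_add_sq_eq_prime {a c u v : ℤ} (h : a ^ 2 + 4 * c ^ 2 = n)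
    (huv : (n : ℤ) = u ^ 2 + 4 * v ^ 2) : c = v ∨ c = -v := by
  have hn : Prime (n : ℤ) := Nat.prime_iff_prime_int.1 Fact.out
  have hn0 : (0 : ℤ) < n := by exact_mod_cast (Fact.out : n.Prime).pos
  have key : ∀ w : ℤ, (n : ℤ) = u ^ 2 + 4 * w ^ 2 → (n : ℤ) ∣ a * w - c * u → c ^ 2 = w ^ 2 := by
    rintro w hw ⟨k, hk⟩
    have h1 : (n : ℤ) ^ 2 = (a * u + 4 * c * w) ^ 2 + 4 * (a * w - c * u) ^ 2 := by
      rw [sq]; nth_rewrite 1 [← h]; rw [hw]; ring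
    rw [hk] at h1
    have hk0 : k = 0 := by
      by_contra hk0
      have : 0 < k ^ 2 := by positivity
      nlinarith [sq_nonneg (a * u + 4 * c * w), mul_pos hn0 hn0]
    have h2 : a * w = c * u := by rw [hk0] at hk; linarith
    have h3 : (n : ℤ) * (w ^ 2 - c ^ 2) = 0 := by
      have : (a * w) ^ 2 = (c * u) ^ 2 := by rw [h2]
      have e1 : a ^ 2 = n - 4 * c ^ 2 := by linarith
      have e2 : u ^ 2 = n - 4 * w ^ 2 := by linarith
      rw [mul_pow, mul_pow, e1, e2] at this
      linarith
    have := (mul_eq_zero.1 h3).resolve_left hn0.ne'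
    linarith
  have hdvd : (n : ℤ) ∣ (a * v - c * u) * (a * -v - c * u) := by
    refine ⟨c ^ 2 - v ^ 2, ?_⟩
    have e1 : a ^ 2 = n - 4 * c ^ 2 := by linarith
    have e2 : u ^ 2 = n - 4 * v ^ 2 := by linarith
    linear_combination (-v ^ 2) * e1 + c ^ 2 * e2
  have hsq : c ^ 2 = v ^ 2 := by
    rcases hn.dvd_or_dvd hdvd with h' | h'
    · exact key v huv h'
    · rw [key (-v) (by rw [huv]; ring) h']; ring
  exact sq_eq_sq_iff_eq_or_eq_neg.1 hsq

include hn4 hg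

theorem quartic_jacobiSum {χ : MulChar (ZMod n) ℂ} (hχ : χ (g : ZMod n) = Complex.I) {u v : ℤ}
    (huv : (n : ℤ) = u ^ 2 + 4 * v ^ 2) :
    ∃ a s : ℤ, (s = 1 ∨ s = -1) ∧ jacobiSum χ χ = a + 2 * s * v * Complex.I ∧
      jacobiSum χ⁻¹ χ⁻¹ = a - 2 * s * v * Complex.I := by
  have hχ1 : χ ≠ 1 := by
    rintro rfl
    rw [MulChar.one_apply_coe] at hχ
    simpa using congrArg Complex.re hχ
  have hχ2 : χ * χ ≠ 1 := by
    intro h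
    have := congrArg (fun φ : MulChar (ZMod n) ℂ => φ (g : ZMod n)) h
    simp only [MulChar.mul_apply, hχ, Complex.I_mul_I, MulChar.one_apply_coe] at this
    norm_num at this
  have hχ4 : χ ^ 4 = 1 := by
    ext x
    obtain ⟨k, rfl⟩ := exists_nat_pow_eq hg x
    rw [MulChar.pow_apply_coe, MulChar.one_apply_coe, Units.val_pow_eq_pow_val, map_pow, hχ,
      ← pow_mul, mul_comm, pow_mul, Complex.I_pow_four, one_pow]
  have hconj : jacobiSum χ⁻¹ χ⁻¹ = starRingEnd ℂ (jacobiSum χ χ) := by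
    simp only [jacobiSum, map_sum, map_mul, starRingEnd_apply, MulChar.star_apply']
  obtain ⟨z, hz, hJ⟩ := exists_jacobiSum_eq_neg_one_add (n := 4) (by norm_num) hχ4 hχ4
    (by rw [ZMod.card]; omega) Complex.isPrimitiveRoot_I
  obtain ⟨c, d, rfl⟩ : ∃ c d : ℤ, z = c + d * Complex.I := by
    clear hJ
    induction hz using Algebra.adjoin_induction with
    | mem x hx => exact ⟨0, 1, by simpa using hx⟩
    | algebraMap r => exact ⟨r, 0, by simp⟩
    | add x y _ _ hx hy =>
      obtain ⟨c, d, rfl⟩ := hx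
      obtain ⟨c', d', rfl⟩ := hy
      exact ⟨c + c', d + d', by push_cast; ring⟩
    | mul x y _ _ hx hy =>
      obtain ⟨c, d, rfl⟩ := hx
      obtain ⟨c', d', rfl⟩ := hy
      exact ⟨c * c' - d * d', c * d' + d * c', by
        push_cast; linear_combination (d * d' : ℂ) * Complex.I_mul_I⟩
  -- As (i-1)² = -2i, the sum is -1 modulo 2 in ℤ[i]; its even imaginary part brings in the form
  -- x²+4y².
  have hJ' : jacobiSum χ χ = ((2 * d - 1 : ℤ) : ℂ) - 2 * c * Complex.I := by
    rw [hJ]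
    push_cast
    linear_combination (c + d * Complex.I - 2 * d : ℂ) * Complex.I_mul_I
  have hJc : jacobiSum χ⁻¹ χ⁻¹ = ((2 * d - 1 : ℤ) : ℂ) + 2 * c * Complex.I := by
    rw [hconj, hJ']
    simp [Complex.conj_ofNat]
  have hnorm := jacobiSum_mul_jacobiSum_inv (F := ZMod n) (F' := ℂ)
    (by rw [ringChar.eq_zero, ZMod.ringChar_zmod_n]; exact (NeZero.ne n).symm) hχ1 hχ1 hχ2
  have hint : (2 * d - 1) ^ 2 + 4 * c ^ 2 = (n : ℤ) := by
    rw [hJ', hJc, ZMod.card] at hnorm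
    have : ((2 * d - 1 : ℤ) : ℂ) ^ 2 + 4 * c ^ 2 = n := by
      linear_combination hnorm + 4 * c ^ 2 * Complex.I_mul_I
    exact_mod_cast this
  rcases eq_or_eq_neg_of_sq_add_sq_eq_prime hint huv with rfl | rfl
  · exact ⟨2 * d - 1, -1, Or.inr rfl, by rw [hJ']; push_cast; ring, by rw [hJc]; push_cast; ring⟩
  · exact ⟨2 * d - 1, 1, Or.inl rfl, by rw [hJ']; push_cast; ring, by rw [hJc]; push_cast; ring⟩

/-- A character that is constant on each class, with value c^i on C_i, turns its Gauss sum into a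
combination of the periods; here c is i, -i and -1. -/
theorem quartic_gaussSums {χ : MulChar (ZMod n) ℂ} (hχ : χ (g : ZMod n) = Complex.I) {ζ : ℂ}
    (hζ : ζ ^ n = 1) :
    gaussSum χ (AddChar.zmodChar n hζ) = period ζ g 0 + Complex.I * period ζ g 1
        - period ζ g 2 - Complex.I * period ζ g 3 ∧
    gaussSum χ⁻¹ (AddChar.zmodChar n hζ) = period ζ g 0 - Complex.I * period ζ g 1
        - period ζ g 2 + Complex.I * period ζ g 3 ∧
    gaussSum (χ * χ) (AddChar.zmodChar n hζ) = period ζ g 0 - period ζ g 1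
        + period ζ g 2 - period ζ g 3 := by
  have hI3 : Complex.I ^ 3 = -Complex.I := Complex.I_pow_three
  have key : ∀ φ : MulChar (ZMod n) ℂ, ∀ c : ℂ, (∀ x i, χ x = Complex.I ^ i → φ x = c ^ i) →
      gaussSum φ (AddChar.zmodChar n hζ) = period ζ g 0 + c * period ζ g 1
        + c ^ 2 * period ζ g 2 + c ^ 3 * period ζ g 3 := by
    intro φ c hc
    have : ∀ i, ∑ x ∈ cycClass g i, φ x * AddChar.zmodChar n hζ x = c ^ i * period ζ g i := by
      intro i
      rw [period, Finset.mul_sum]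
      refine Finset.sum_congr rfl fun x hx => ?_
      rw [hc x i ((mem_cycClass_iff hg hχ).1 hx), AddChar.zmodChar_apply]
    rw [gaussSum, sum_eq_sum_cycClass hn4 hg, this, this, this, this,
      MulChar.map_zero]
    simp
  refine ⟨?_, ?_, ?_⟩
  · rw [key χ Complex.I fun x i h => h, Complex.I_sq, hI3]; ring
  · rw [key χ⁻¹ (-Complex.I) fun x i h => ?_, Complex.ext_iff]
    · simp [pow_succ]; constructor <;> ring
    · rw [MulChar.inv_apply_eq_inv', h, ← inv_pow, Complex.inv_I]
  · rw [key (χ * χ) (-1) fun x i h => ?_]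
    · ring
    · rw [MulChar.mul_apply, h, ← mul_pow, Complex.I_mul_I]

theorem sum_period {K : Type*} [Field K] {η : K} (hη : IsPrimitiveRoot η n) :
    period η g 0 + period η g 1 + period η g 2 + period η g 3 = -1 := by
  have hn : 1 < n := (Fact.out : n.Prime).one_lt
  have h1 : AddChar.zmodChar n hη.pow_eq_one ≠ 1 := by
    intro h
    replace h := DFunLike.congr_fun h 1
    have : Fact (1 < n) := ⟨hn⟩
    rw [AddChar.zmodChar_apply, AddChar.one_apply, ZMod.val_one, pow_one] at h
    exact hη.ne_one hn h
  have h2 := AddChar.sum_eq_zero_of_ne_one h1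
  rw [sum_eq_sum_cycClass hn4 hg, AddChar.map_zero_eq_one] at h2
  simp only [AddChar.zmodChar_apply] at h2
  simp only [period]
  linear_combination h2

/-- G(χ)G(χ⁻¹) = χ(-1)n gives the sum of the squares of η_0-η_2 and η_1-η_3; comparing G(χ)² and
G(χ⁻¹)² through the Jacobi sums gives their product. The squares of their sum and difference follow.
The sign s depends on the choices of g and ζ and stays unspecified. -/
theorem quartic_periods_complex {u v : ℤ} (huv : (n : ℤ) = u ^ 2 + 4 * v ^ 2) {ζ : ℂ}
    (hζ : IsPrimitiveRoot ζ n) :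
    ∃ s ε : ℤ, (s = 1 ∨ s = -1) ∧ (n % 8 = 1 → ε = 1) ∧ (n % 8 = 5 → ε = -1) ∧
      (period ζ g 0 - period ζ g 1 + period ζ g 2 - period ζ g 3) ^ 2 = n ∧
      (period ζ g 0 + period ζ g 1 - period ζ g 2 - period ζ g 3) ^ 2 = ε * n +
        2 * s * v * (period ζ g 0 - period ζ g 1 + period ζ g 2 - period ζ g 3) ∧
      (period ζ g 1 + period ζ g 2 - period ζ g 3 - period ζ g 0) ^ 2 = ε * n -
        2 * s * v * (period ζ g 0 - period ζ g 1 + period ζ g 2 - period ζ g 3) := by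
  obtain ⟨χ, hχ⟩ := exists_quartic_mulChar hn4 hg
  obtain ⟨a, s, hs, hJ, hJ'⟩ := quartic_jacobiSum hn4 hg hχ huv
  obtain ⟨h1, h2, h3⟩ := quartic_gaussSums hn4 hg hχ hζ.pow_eq_one
  have hψ := AddChar.zmodChar_primitive_of_primitive_root n hζ
  generalize AddChar.zmodChar n hζ.pow_eq_one = ψ at *
  have hχ1 : χ ≠ 1 := by
    rintro rfl
    rw [MulChar.one_apply_coe] at hχ
    simpa using congrArg Complex.re hχ
  have hχ2 : χ * χ ≠ 1 := by
    intro h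
    have := congrArg (fun φ : MulChar (ZMod n) ℂ => φ (g : ZMod n)) h
    simp only [MulChar.mul_apply, hχ, Complex.I_mul_I, MulChar.one_apply_coe] at this
    norm_num at this
  have hinv : χ⁻¹ * χ⁻¹ = χ * χ := by
    ext x
    obtain ⟨k, rfl⟩ := exists_nat_pow_eq hg x
    rw [MulChar.mul_apply, MulChar.mul_apply, MulChar.inv_apply_eq_inv', Units.val_pow_eq_pow_val,
      map_pow, hχ, ← inv_pow, Complex.inv_I, ← mul_pow, ← mul_pow]
    simp
  have hord : orderOf g = n - 1 := by
    rw [orderOf_eq_card_of_forall_mem_zpowers hg, Nat.card_eq_fintype_card,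
      ZMod.card_units_eq_totient, Nat.totient_prime Fact.out]
  have hn1 : 1 < n := (Fact.out : n.Prime).one_lt
  have hneg : ((-1 : ZMod n)) = (g : ZMod n) ^ ((n - 1) / 2) := by
    have hsq : ((g : ZMod n) ^ ((n - 1) / 2)) ^ 2 = 1 := by
      rw [← pow_mul, Nat.div_mul_cancel (by omega), ← hord]
      rw [← Units.val_pow_eq_pow_val, pow_orderOf_eq_one, Units.val_one]
    rcases sq_eq_sq_iff_eq_or_eq_neg.1 (hsq.trans (one_pow 2).symm) with h | h
    · exfalso
      have : g ^ ((n - 1) / 2) = 1 := by ext; simpa using h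
      have := orderOf_dvd_of_pow_eq_one this
      rw [hord] at this
      have := Nat.le_of_dvd (by omega) this
      omega
    · exact h.symm
  have hε : χ (-1) = Complex.I ^ ((n - 1) / 2) := by rw [hneg, map_pow, hχ]
  have hε2 : χ (-1) * χ (-1) = 1 := by rw [← map_mul]; simp
  have hG2 : gaussSum (χ * χ) ψ ^ 2 = n := by
    have hq : (χ * χ)⁻¹ = χ * χ := by rw [mul_inv, hinv]
    have := gaussSum_mul_gaussSum_eq_card hχ2 hψ
    rw [hq, ← mul_gaussSum_inv_eq_gaussSum (χ * χ) ψ, MulChar.mul_apply, hε2, one_mul,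
      ZMod.card] at this
    rw [← mul_gaussSum_inv_eq_gaussSum (χ * χ) ψ, MulChar.mul_apply, hε2, one_mul, sq, this]
  have hGG : gaussSum χ ψ * gaussSum χ⁻¹ ψ = χ (-1) * n := by
    have h := gaussSum_mul_gaussSum_eq_card hχ1 hψ
    have h' := mul_gaussSum_inv_eq_gaussSum χ⁻¹ ψ
    rw [MulChar.inv_apply_eq_inv', inv_eq_of_mul_eq_one_right hε2] at h'
    rw [ZMod.card] at h
    rw [← h', ← h]
    ring
  have hJG := jacobiSum_mul_nontrivial hχ2 ψ
  have hJG' := jacobiSum_mul_nontrivial (hinv ▸ hχ2) ψ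
  rw [hinv] at hJG'
  rw [hJ] at hJG
  rw [hJ'] at hJG'
  -- χ(-1) = i^((n-1)/2), which is where the residue of n modulo 8 enters.
  obtain ⟨ε, hεχ, hε1, hε5⟩ : ∃ ε : ℤ, χ (-1) = ε ∧ (n % 8 = 1 → ε = 1) ∧ (n % 8 = 5 → ε = -1) := by
    rcases (show n % 8 = 1 ∨ n % 8 = 5 by omega) with h | h
    · refine ⟨1, ?_, fun _ => rfl, fun _ => by omega⟩
      rw [hε, Int.cast_one, ← pow_zero Complex.I, I_pow_eq_I_pow_iff]
      omega
    · refine ⟨-1, ?_, fun _ => by omega, fun _ => rfl⟩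
      rw [hε, Int.cast_neg, Int.cast_one, ← Complex.I_sq, I_pow_eq_I_pow_iff]
      omega
  rw [hεχ] at hGG
  rw [h1, h2] at hGG
  rw [h1, h3] at hJG
  rw [h2, h3] at hJG'
  rw [h3] at hG2
  set A := period ζ g 0
  set B := period ζ g 1
  set C := period ζ g 2
  set D := period ζ g 3
  have hAB : (A - C) ^ 2 + (B - D) ^ 2 = ε * n := by
    linear_combination hGG + (B - D) ^ 2 * Complex.I_sq
  -- Subtracting the two Jacobi relations eliminates the real part a, so its sign is never needed.
  have hAB2 : 2 * ((A - C) * (B - D)) = 2 * s * v * (A - B + C - D) := by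
    have : 2 * Complex.I * (2 * ((A - C) * (B - D))) =
      2 * Complex.I * (2 * s * v * (A - B + C - D)) := by linear_combination hJG' - hJG
    exact mul_left_cancel₀ (by simp) this
  refine ⟨s, ε, hs, hε1, hε5, hG2, ?_, ?_⟩
  · linear_combination hAB + hAB2
  · linear_combination hAB - hAB2

-- The nth cyclotomic polynomial is the minimal polynomial of ζ over ℤ, so it divides f, and it
-- vanishes at a primitive nth root of unity in any field. Integral relations between periods thus
-- pass to positive characteristic.
omit hn4 hg in
theorem aeval_eq_zero_of_isPrimitiveRoot {K : Type*} [Field K] {η : K} (hη : IsPrimitiveRoot η n)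
    {ζ : ℂ} (hζ : IsPrimitiveRoot ζ n) {f : ℤ[X]} (hf : aeval ζ f = 0) : aeval η f = 0 := by
  have hn : 0 < n := (Fact.out : n.Prime).pos
  have h : cyclotomic n ℤ ∣ f := by
    rw [cyclotomic_eq_minpoly hζ hn]
    exact minpoly.isIntegrallyClosed_dvd (hζ.isIntegral hn) hf
  obtain ⟨f', rfl⟩ := h
  rw [map_mul]
  refine mul_eq_zero_of_left ?_ _
  have := hη.isRoot_cyclotomic hn
  rwa [← map_cyclotomic_int, IsRoot.def, eval_map, ← algebraMap_int_eq, ← aeval_def] at this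

theorem quartic_periods_of_mod_eight_eq_five (hn8 : n % 8 = 5) {u v : ℤ}
    (huv : (n : ℤ) = u ^ 2 + 4 * v ^ 2) {K : Type*} [Field K] {η : K}
    (hη : IsPrimitiveRoot η n) :
    ∃ s : ℤ, (s = 1 ∨ s = -1) ∧
      (period η g 0 - period η g 1 + period η g 2 - period η g 3) ^ 2 = n ∧
      (period η g 0 + period η g 1 - period η g 2 - period η g 3) ^ 2 = -n +
        2 * s * v * (period η g 0 - period η g 1 + period η g 2 - period η g 3) ∧
      (period η g 1 + period η g 2 - period η g 3 - period η g 0) ^ 2 = -n -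
        2 * s * v * (period η g 0 - period η g 1 + period η g 2 - period η g 3) := by
  have hn0 : n ≠ 0 := (Fact.out : n.Prime).ne_zero
  have hζ := Complex.isPrimitiveRoot_exp n hn0
  generalize Complex.exp (2 * Real.pi * Complex.I / n) = ζ at hζ
  obtain ⟨s, ε, hs, -, hε, h1, h2, h3⟩ := quartic_periods_complex hn4 hg huv hζ
  rw [hε hn8] at h2 h3
  refine ⟨s, hs, ?_, ?_, ?_⟩
  · have := aeval_eq_zero_of_isPrimitiveRoot hη hζ (f := (periodPoly g 0 - periodPoly g 1 +
      periodPoly g 2 - periodPoly g 3) ^ 2 - (n : ℤ[X])) (by simp [aeval_periodPoly, h1])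
    simpa [aeval_periodPoly, sub_eq_zero, map_ofNat] using this
  · have := aeval_eq_zero_of_isPrimitiveRoot hη hζ (f := (periodPoly g 0 + periodPoly g 1 -
      periodPoly g 2 - periodPoly g 3) ^ 2 - (-(n : ℤ[X]) + ((2 * s * v : ℤ) : ℤ[X]) *
      (periodPoly g 0 - periodPoly g 1 + periodPoly g 2 - periodPoly g 3)))
      (by simp [aeval_periodPoly, h2, map_ofNat])
    simpa [aeval_periodPoly, sub_eq_zero, map_ofNat] using this
  · have := aeval_eq_zero_of_isPrimitiveRoot hη hζ (f := (periodPoly g 1 + periodPoly g 2 -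
      periodPoly g 3 - periodPoly g 0) ^ 2 - (-(n : ℤ[X]) - ((2 * s * v : ℤ) : ℤ[X]) *
      (periodPoly g 0 - periodPoly g 1 + periodPoly g 2 - periodPoly g 3)))
      (by simp [aeval_periodPoly, h3, map_ofNat])
    simpa [aeval_periodPoly, sub_eq_zero, map_ofNat] using this

theorem quartic_periods_of_mod_eight_eq_one (hn8 : n % 8 = 1) {u v : ℤ}
    (huv : (n : ℤ) = u ^ 2 + 4 * v ^ 2) {K : Type*} [Field K] {η : K}
    (hη : IsPrimitiveRoot η n) :
    ∃ s : ℤ, (s = 1 ∨ s = -1) ∧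
      (period η g 0 - period η g 1 + period η g 2 - period η g 3) ^ 2 = n ∧
      (period η g 0 + period η g 1) ^ 2 + (period η g 0 + period η g 1) =
        ((n - 1) / 4 : ℕ) + s * (v / 2 : ℤ) *
          (period η g 0 - period η g 1 + period η g 2 - period η g 3) ∧
      (period η g 1 + period η g 2) ^ 2 + (period η g 1 + period η g 2) =
        ((n - 1) / 4 : ℕ) - s * (v / 2 : ℤ) *
          (period η g 0 - period η g 1 + period η g 2 - period η g 3) := by
  have hn0 : n ≠ 0 := (Fact.out : n.Prime).ne_zero
  have hζ := Complex.isPrimitiveRoot_exp n hn0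
  generalize Complex.exp (2 * Real.pi * Complex.I / n) = ζ at hζ
  obtain ⟨s, ε, hs, hε, -, h1, h2, h3⟩ := quartic_periods_complex hn4 hg huv hζ
  have h0 := sum_period hn4 hg hζ
  rw [hε hn8] at h2 h3
  -- An odd v would force u²+4v² ≡ 5 mod 8.
  have hv : v = 2 * (v / 2) := by
    have : (n : ℤ) % 8 = 1 := by omega
    rw [huv] at this
    rcases Int.even_or_odd' v with ⟨k, rfl | rfl⟩
    · omega
    · exfalso
      rcases Int.even_or_odd' u with ⟨l, rfl | rfl⟩
      · ring_nf at this; omega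
      · have e : ((2 * l + 1) ^ 2 + 4 * (2 * k + 1) ^ 2 : ℤ) =
          4 * (l * (l + 1)) + 16 * (k * k + k) + 5 := by ring
        obtain ⟨t, ht⟩ := (Int.even_mul_succ_self l).two_dvd
        rw [e, ht] at this
        omega
  have hm : n = 4 * ((n - 1) / 4) + 1 := by omega
  generalize (n - 1) / 4 = m at hm ⊢
  generalize v / 2 = w at hv ⊢
  have hvC : (v : ℂ) = 2 * w := by rw [hv]; push_cast; ring
  have hnC : (n : ℂ) = 4 * m + 1 := by
    have : (n : ℂ) = ((4 * m + 1 : ℕ) : ℂ) := by rw [← hm]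
    rw [this]; push_cast; ring
  rw [hvC, hnC] at h2 h3
  refine ⟨s, hs, ?_, ?_, ?_⟩
  · have := aeval_eq_zero_of_isPrimitiveRoot hη hζ
      (f := (periodPoly g 0 - periodPoly g 1 + periodPoly g 2 - periodPoly g 3) ^ 2 - (n : ℤ[X]))
      (by simp [aeval_periodPoly, h1])
    simpa [aeval_periodPoly, sub_eq_zero] using this
  · have := aeval_eq_zero_of_isPrimitiveRoot hη hζ
      (f := (periodPoly g 0 + periodPoly g 1) ^ 2 + (periodPoly g 0 + periodPoly g 1) -
      ((m : ℤ[X]) + (s : ℤ[X]) * (w : ℤ[X]) *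
        (periodPoly g 0 - periodPoly g 1 + periodPoly g 2 - periodPoly g 3))) (by
        simp only [map_sub, map_add, map_mul, map_pow, aeval_periodPoly, map_natCast, map_intCast]
        push_cast at h2
        -- The factor 4 is cancelled over ℂ, before the transfer, because K may have characteristic
        -- 2.
        have h2' : 4 * ((period ζ g 0 + period ζ g 1) ^ 2 + (period ζ g 0 + period ζ g 1) -
          (m + s * w * (period ζ g 0 - period ζ g 1 + period ζ g 2 - period ζ g 3))) = 0 := by
          linear_combination h2 + (1 + 3 * (period ζ g 0 + period ζ g 1) -
            (period ζ g 2 + period ζ g 3)) * h0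
        simpa using h2')
    simpa [aeval_periodPoly, sub_eq_zero] using this
  · have := aeval_eq_zero_of_isPrimitiveRoot hη hζ
      (f := (periodPoly g 1 + periodPoly g 2) ^ 2 + (periodPoly g 1 + periodPoly g 2) -
      ((m : ℤ[X]) - (s : ℤ[X]) * (w : ℤ[X]) *
        (periodPoly g 0 - periodPoly g 1 + periodPoly g 2 - periodPoly g 3))) (by
        simp only [map_sub, map_add, map_mul, map_pow, aeval_periodPoly, map_natCast, map_intCast]
        push_cast at h3
        have h2' : 4 * ((period ζ g 1 + period ζ g 2) ^ 2 + (period ζ g 1 + period ζ g 2) -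
          (m - s * w * (period ζ g 0 - period ζ g 1 + period ζ g 2 - period ζ g 3))) = 0 := by
          linear_combination h3 + (1 + 3 * (period ζ g 1 + period ζ g 2) -
            (period ζ g 3 + period ζ g 0)) * h0
        simpa using h2')
    simpa [aeval_periodPoly, sub_eq_zero] using this

end Gauss

/-! ### Linear span and minimal polynomial from a reduced fraction -/

section Sequence

theorem natDegree_X_pow_sub_one {R : Type*} [Ring R] [Nontrivial R] (n : ℕ) :
    (X ^ n - 1 : R[X]).natDegree = n := by
  rw [← C_1, natDegree_X_pow_sub_C]

theorem monic_X_pow_sub_one {R : Type*} [Ring R] {n : ℕ} (hn : n ≠ 0) :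
    (X ^ n - 1 : R[X]).Monic := by
  rw [← C_1]; exact monic_X_pow_sub_C 1 hn

theorem X_pow_sub_one_ne_zero {R : Type*} [Ring R] [Nontrivial R] {n : ℕ} (hn : n ≠ 0) :
    (X ^ n - 1 : R[X]) ≠ 0 :=
  (monic_X_pow_sub_one hn).ne_zero

variable {F : Type*} [Field F]

/-- The recurrence at index i is the vanishing of the ith coefficient of c times the generating
function, because c₀ = 1 and c has degree at most l. -/
theorem isFeedbackPoly_iff {s : ℕ → F} {l : ℕ} {c : F[X]} :
    IsFeedbackPoly s l c ↔ c.coeff 0 = 1 ∧ c.natDegree ≤ l ∧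
      ∀ i, l ≤ i → PowerSeries.coeff i ((c : PowerSeries F) * PowerSeries.mk s) = 0 := by
  refine and_congr_right fun h0 => and_congr_right fun hl => forall_congr' fun i =>
    forall_congr' fun hi => ?_
  have hsum : PowerSeries.coeff i ((c : PowerSeries F) * PowerSeries.mk s) =
      s i + ∑ j ∈ Finset.Icc 1 l, c.coeff j * s (i - j) := by
    rw [PowerSeries.coeff_mul, Finset.Nat.sum_antidiagonal_eq_sum_range_succ
      (fun a b => PowerSeries.coeff a (c : PowerSeries F) * PowerSeries.coeff b (PowerSeries.mk s))]
    simp only [coeff_coe, PowerSeries.coeff_mk]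
    have hsub : insert 0 (Finset.Icc 1 l) ⊆ Finset.range i.succ := by
      intro j hj
      simp only [Finset.mem_insert, Finset.mem_Icc, Finset.mem_range] at *
      omega
    rw [← Finset.sum_subset hsub, Finset.sum_insert (by simp), h0]
    · simp
    · intro j _ hj
      simp only [Finset.mem_insert, Finset.mem_Icc] at hj
      rw [coeff_eq_zero_of_natDegree_lt (by omega), zero_mul]
  rw [hsum, neg_eq_iff_add_eq_zero]

theorem mk_mul_X_pow_sub_one {s : ℕ → F} {n : ℕ} (hs : ∀ i, s (i + n) = s i) :
    PowerSeries.mk s * ((X ^ n - 1 : F[X]) : PowerSeries F) =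
      -((∑ i ∈ Finset.range n, C (s i) * X ^ i : F[X]) : PowerSeries F) := by
  ext i
  rw [map_neg, coeff_coe]
  push_cast
  rw [mul_sub, mul_one, map_sub, PowerSeries.coeff_mul_X_pow', PowerSeries.coeff_mk]
  simp only [finsetSum_coeff, coeff_C_mul, coeff_X_pow, mul_ite, mul_one, mul_zero,
    Finset.sum_ite_eq, Finset.mem_range, PowerSeries.coeff_mk]
  by_cases h : i < n
  · rw [if_neg (by omega), if_pos h, zero_sub]
  · rw [if_pos (by omega), if_neg h, ← hs (i - n), Nat.sub_add_cancel (by omega)]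
    simp

/-- A reduced fraction `-Λ'/m = Λ/(1-x^n)` for the generating function of a sequence of
period `n`. -/
structure IsReducedFraction (n : ℕ) (s : ℕ → F) (m h l : F[X]) : Prop where
  monic : m.Monic
  mul_eq : m * h = X ^ n - 1
  numerator : ∑ i ∈ Finset.range n, C (s i) * X ^ i = h * l
  coprime : IsCoprime m l

theorem exists_isReducedFraction {n : ℕ} (hn : 0 < n) (s : ℕ → F) :
    ∃ m h l, IsReducedFraction n s m h l := by
  classical
  set L : F[X] := ∑ i ∈ Finset.range n, C (s i) * X ^ i
  have h0 : (X ^ n - 1 : F[X]) ≠ 0 := X_pow_sub_one_ne_zero hn.ne'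
  obtain ⟨l, hl⟩ := EuclideanDomain.gcd_dvd_left L (X ^ n - 1)
  obtain ⟨m, hm⟩ := EuclideanDomain.gcd_dvd_right L (X ^ n - 1)
  set d := EuclideanDomain.gcd L (X ^ n - 1)
  have hd : d ≠ 0 := by rintro h; rw [h, zero_mul] at hm; exact h0 hm
  have hm0 : m ≠ 0 := by rintro rfl; rw [mul_zero] at hm; exact h0 hm
  have hlc : m.leadingCoeff ≠ 0 := leadingCoeff_ne_zero.2 hm0
  have hbez : d = L * EuclideanDomain.gcdA L (X ^ n - 1) +
    (X ^ n - 1) * EuclideanDomain.gcdB L (X ^ n - 1) := EuclideanDomain.gcd_eq_gcd_ab _ _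
  have hcop : IsCoprime m l := by
    refine ⟨EuclideanDomain.gcdB L (X ^ n - 1), EuclideanDomain.gcdA L (X ^ n - 1), ?_⟩
    refine mul_left_cancel₀ hd ?_
    linear_combination -hbez - EuclideanDomain.gcdA L (X ^ n - 1) * hl -
      EuclideanDomain.gcdB L (X ^ n - 1) * hm
  have hCC : (C m.leadingCoeff * C m.leadingCoeff⁻¹ : F[X]) = 1 := by
    rw [← C_mul, mul_inv_cancel₀ hlc, C_1]
  refine ⟨m * C m.leadingCoeff⁻¹, C m.leadingCoeff * d, C m.leadingCoeff⁻¹ * l,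
    monic_mul_leadingCoeff_inv hm0, ?_, ?_, ?_⟩
  · rw [hm]; linear_combination (m * d) * hCC
  · linear_combination hl - (d * l) * hCC
  · have hu : IsUnit (C m.leadingCoeff⁻¹ : F[X]) := isUnit_C.2 (inv_ne_zero hlc).isUnit
    exact (isCoprime_mul_unit_right_left hu _ _).2 ((isCoprime_mul_unit_left_right hu _ _).2 hcop)

namespace IsReducedFraction

variable {n : ℕ} {s : ℕ → F} {m h l : F[X]}

theorem ne_zero_and_ne_zero (H : IsReducedFraction n s m h l) (hn : 0 < n) : m ≠ 0 ∧ h ≠ 0 := by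
  have h0 : (X ^ n - 1 : F[X]) ≠ 0 := X_pow_sub_one_ne_zero hn.ne'
  rw [← H.mul_eq] at h0
  exact ⟨left_ne_zero_of_mul h0, right_ne_zero_of_mul h0⟩

theorem mk_mul (H : IsReducedFraction n s m h l) (hn : 0 < n) (hs : ∀ i, s (i + n) = s i) :
    (m : PowerSeries F) * PowerSeries.mk s = -(l : PowerSeries F) := by
  have h1 := mk_mul_X_pow_sub_one hs
  rw [← H.mul_eq, H.numerator] at h1
  push_cast at h1
  have h0 : (h : PowerSeries F) ≠ 0 := by
    rw [Ne, Polynomial.coe_eq_zero_iff]; exact (H.ne_zero_and_ne_zero hn).2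
  refine mul_left_cancel₀ h0 ?_
  linear_combination h1

/-- If c times the generating function is a polynomial P, then mP = -cl, and m is coprime to l. -/
theorem dvd_of_isFeedbackPoly (H : IsReducedFraction n s m h l) (hn : 0 < n)
    (hs : ∀ i, s (i + n) = s i) {k : ℕ} {c : F[X]} (hc : IsFeedbackPoly s k c) : m ∣ c := by
  obtain ⟨-, -, hc⟩ := isFeedbackPoly_iff.1 hc
  obtain ⟨P, hP⟩ : ∃ P : F[X], (c : PowerSeries F) * PowerSeries.mk s = P := by
    refine ⟨PowerSeries.trunc k ((c : PowerSeries F) * PowerSeries.mk s), ?_⟩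
    ext i
    rw [coeff_coe, PowerSeries.coeff_trunc]
    split_ifs with hi
    · rfl
    · exact hc i (by omega)
  have h1 : m * P = -(c * l) := by
    apply Polynomial.coe_injective F
    push_cast
    rw [← hP]
    linear_combination (c : PowerSeries F) * H.mk_mul hn hs
  refine H.coprime.dvd_of_dvd_mul_right ?_
  exact ⟨-P, by linear_combination h1⟩

theorem natDegree_le_of_isFeedbackPoly (H : IsReducedFraction n s m h l) (hn : 0 < n)
    (hs : ∀ i, s (i + n) = s i) {k : ℕ} {c : F[X]} (hc : IsFeedbackPoly s k c) :
    m.natDegree ≤ c.natDegree :=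
  natDegree_le_of_dvd (H.dvd_of_isFeedbackPoly hn hs hc) (by
    rintro rfl
    exact zero_ne_one hc.1)

theorem isFeedbackPoly (H : IsReducedFraction n s m h l) (hn : 0 < n)
    (hs : ∀ i, s (i + n) = s i) :
    IsFeedbackPoly s m.natDegree (C (m.coeff 0)⁻¹ * m) := by
  have hm0 : m.coeff 0 ≠ 0 := by
    intro h0
    have := congrArg (fun f => coeff f 0) H.mul_eq
    simp [mul_coeff_zero, h0, hn.ne] at this
  refine isFeedbackPoly_iff.2 ⟨by simp [hm0], natDegree_C_mul_le _ _, fun i hi => ?_⟩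
  push_cast
  rw [mul_assoc, H.mk_mul hn hs, PowerSeries.coeff_C_mul, map_neg, coeff_coe]
  -- The fraction is proper: deg(hl) < n = deg(mh), so deg l < deg m and the recurrence holds from
  -- index deg m onwards.
  have hl : l.coeff i = 0 := by
    by_cases hl0 : l = 0
    · simp [hl0]
    apply coeff_eq_zero_of_natDegree_lt
    have hh := (H.ne_zero_and_ne_zero hn).2
    have h1 : (h * l).natDegree < n := by
      rw [← H.numerator]
      refine lt_of_le_of_lt (natDegree_sum_le_of_forall_le (n := n - 1) _ _ fun i hi => ?_)
        (by omega)
      have := natDegree_C_mul_X_pow_le (s i) i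
      have := Finset.mem_range.1 hi
      omega
    have h2 : (m * h).natDegree = n := by rw [H.mul_eq]; exact natDegree_X_pow_sub_one n
    rw [natDegree_mul hh hl0] at h1
    rw [H.monic.natDegree_mul' hh] at h2
    omega
  rw [hl, neg_zero, mul_zero]

theorem isMinimalPoly (H : IsReducedFraction n s m h l) (hn : 0 < n)
    (hs : ∀ i, s (i + n) = s i) : IsMinimalPoly s m :=
  ⟨H.monic, ⟨_, H.isFeedbackPoly hn hs⟩,
    fun _ ⟨_, hc⟩ => H.natDegree_le_of_isFeedbackPoly hn hs hc⟩

theorem linearSpan_eq (H : IsReducedFraction n s m h l) (hn : 0 < n)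
    (hs : ∀ i, s (i + n) = s i) : linearSpan s = m.natDegree := by
  refine le_antisymm (sInf_le ⟨_, ⟨_, H.isFeedbackPoly hn hs⟩, rfl⟩) (le_sInf ?_)
  rintro _ ⟨k, ⟨c, hc⟩, rfl⟩
  exact_mod_cast (H.natDegree_le_of_isFeedbackPoly hn hs hc).trans hc.2.1

theorem isGeneratorPoly (H : IsReducedFraction n s m h l) (hn : 0 < n) :
    IsGeneratorPoly (seqCode n s) m := by
  classical
  refine ⟨H.monic, ⟨h, H.mul_eq.symm⟩, ?_⟩
  have hh := (H.ne_zero_and_ne_zero hn).2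
  -- The gcd of hl and hm is h up to a unit, by coprimality of l and m.
  obtain ⟨t, ht, hu⟩ : ∃ t, EuclideanDomain.gcd (∑ i ∈ Finset.range n, C (s i) * X ^ i)
      ((X : F[X]) ^ n - 1) = h * t ∧ IsUnit t := by
    obtain ⟨t, ht⟩ : h ∣ EuclideanDomain.gcd (∑ i ∈ Finset.range n, C (s i) * X ^ i)
      ((X : F[X]) ^ n - 1) :=
      EuclideanDomain.dvd_gcd ⟨l, H.numerator⟩ ⟨m, by rw [← H.mul_eq, mul_comm]⟩
    refine ⟨t, ht, H.coprime.isUnit_of_dvd' ?_ ?_⟩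
    · have := EuclideanDomain.gcd_dvd_right (∑ i ∈ Finset.range n, C (s i) * X ^ i)
        ((X : F[X]) ^ n - 1)
      rw [ht, ← H.mul_eq, mul_comm m h] at this
      exact (mul_dvd_mul_iff_left hh).1 this
    · have := EuclideanDomain.gcd_dvd_left (∑ i ∈ Finset.range n, C (s i) * X ^ i)
        ((X : F[X]) ^ n - 1)
      rw [ht, H.numerator] at this
      exact (mul_dvd_mul_iff_left hh).1 this
  obtain ⟨t', ht'⟩ := hu.exists_right_inv
  have hdiv : ((X : F[X]) ^ n - 1) / EuclideanDomain.gcd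
      (∑ i ∈ Finset.range n, C (s i) * X ^ i) ((X : F[X]) ^ n - 1) = m * t' := by
    rw [ht]
    refine mul_left_cancel₀ (mul_ne_zero hh hu.ne_zero) ?_
    rw [EuclideanDomain.mul_div_cancel' (mul_ne_zero hh hu.ne_zero), ← H.mul_eq]
    · linear_combination (-m * h) * ht'
    · rw [← ht]; exact EuclideanDomain.gcd_dvd_right _ _
  have hspan : Ideal.span {m * t', (X : F[X]) ^ n - 1} = Ideal.span {m, (X : F[X]) ^ n - 1} := by
    rw [Ideal.span_insert, Ideal.span_insert, Ideal.span_singleton_mul_right_unit]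
    exact IsUnit.of_mul_eq_one t (by rw [mul_comm, ht'])
  rw [seqCode, cyclicCode, cyclicCode, ← hspan, ← hdiv]

end IsReducedFraction

end Sequence

/-! ### Polynomials with prescribed roots among the powers of η -/

section RootPoly

variable {K : Type*} [Field K] {n : ℕ}

theorem rootPoly_monic (η : K) (S : Finset (ZMod n)) : (rootPoly η S).Monic :=
  monic_prod_of_monic _ _ fun _ _ => monic_X_sub_C _

theorem natDegree_rootPoly (η : K) (S : Finset (ZMod n)) : (rootPoly η S).natDegree = S.card := by
  rw [rootPoly, natDegree_prod_of_monic _ _ fun _ _ => monic_X_sub_C _]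
  simp only [natDegree_X_sub_C, Finset.sum_const, smul_eq_mul, mul_one]

theorem pow_val_injective [NeZero n] {η : K} (hη : IsPrimitiveRoot η n) :
    Function.Injective fun j : ZMod n => η ^ j.val := fun i j h =>
  ZMod.val_injective n (hη.pow_inj (ZMod.val_lt i) (ZMod.val_lt j) h)

theorem rootPoly_dvd [NeZero n] {η : K} (hη : IsPrimitiveRoot η n) {S : Finset (ZMod n)}
    {f : K[X]} (hf : ∀ j ∈ S, f.eval (η ^ j.val) = 0) : rootPoly η S ∣ f := by
  refine Finset.prod_dvd_of_coprime ?_ fun j hj => dvd_iff_isRoot.2 (hf j hj)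
  intro i _ j _ hij
  exact isCoprime_X_sub_C_of_isUnit_sub
    (sub_ne_zero.2 fun h => hij (pow_val_injective hη h)).isUnit

theorem rootPoly_union_of_disjoint (η : K) {S T : Finset (ZMod n)} [DecidableEq (ZMod n)]
    (h : Disjoint S T) : rootPoly η (S ∪ T) = rootPoly η S * rootPoly η T :=
  Finset.prod_union h

theorem rootPoly_univ [NeZero n] {η : K} (hη : IsPrimitiveRoot η n) :
    rootPoly η (Finset.univ : Finset (ZMod n)) = X ^ n - 1 := by
  have hn := Nat.pos_of_ne_zero (NeZero.ne n)
  refine (eq_of_monic_of_dvd_of_natDegree_le (rootPoly_monic _ _)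
    (monic_X_pow_sub_one hn.ne') (rootPoly_dvd hη fun j _ => ?_) ?_).symm
  · rw [eval_sub, eval_pow, eval_X, eval_one, ← pow_mul, mul_comm, pow_mul, hη.pow_eq_one,
      one_pow, sub_self]
  · rw [natDegree_rootPoly, Finset.card_univ, ZMod.card]
    exact (natDegree_X_pow_sub_one n).le

theorem rootPoly_erase_zero_mul [NeZero n] [DecidableEq (ZMod n)] {η : K}
    (hη : IsPrimitiveRoot η n) :
    (X - 1) * rootPoly η ((Finset.univ : Finset (ZMod n)).erase 0) = X ^ n - 1 := by
  rw [← rootPoly_univ hη, rootPoly, rootPoly, ← Finset.mul_prod_erase _ _ (Finset.mem_univ 0)]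
  simp

-- Where Λ = hl is nonzero, h is nonzero and mh = 0 forces a root of m. Elsewhere h must vanish,
-- since otherwise m and l would share a root. The degrees of m and h add up to n, so these are all
-- the roots.
open Classical in
theorem IsReducedFraction.map_eq_rootPoly {F : Type*} [Field F] [Algebra F K] [NeZero n]
    {s : ℕ → F} {m h l : F[X]} (H : IsReducedFraction n s m h l) {η : K}
    (hη : IsPrimitiveRoot η n) :
    m.map (algebraMap F K) = rootPoly η (Finset.univ.filter fun j : ZMod n =>
      aeval (η ^ j.val) (∑ i ∈ Finset.range n, C (s i) * X ^ i) ≠ 0) := by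
  have hn := Nat.pos_of_ne_zero (NeZero.ne n)
  set S : Finset (ZMod n) := Finset.univ.filter fun j : ZMod n =>
      aeval (η ^ j.val) (∑ i ∈ Finset.range n, C (s i) * X ^ i) ≠ 0 with hS
  have hmh : ∀ j : ZMod n, aeval (η ^ j.val) m * aeval (η ^ j.val) h = 0 := by
    intro j
    rw [← map_mul, H.mul_eq]
    simp only [map_sub, map_pow, aeval_X, map_one]
    rw [← pow_mul, mul_comm, pow_mul, hη.pow_eq_one, one_pow, sub_self]
  have hmem : ∀ j : ZMod n, j ∈ S ↔ aeval (η ^ j.val) h * aeval (η ^ j.val) l ≠ 0 := by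
    intro j
    rw [hS, Finset.mem_filter, H.numerator, map_mul]
    simp
  have h1 : rootPoly η S ∣ m.map (algebraMap F K) := by
    refine rootPoly_dvd hη fun j hj => ?_
    rw [eval_map_algebraMap]
    exact (mul_eq_zero.1 (hmh j)).resolve_right (left_ne_zero_of_mul ((hmem j).1 hj))
  have h2 : rootPoly η Sᶜ ∣ h.map (algebraMap F K) := by
    refine rootPoly_dvd hη fun j hj => ?_
    rw [eval_map_algebraMap]
    by_contra hh
    rw [Finset.mem_compl, hmem, not_not] at hj
    have hl := (mul_eq_zero.1 hj).resolve_left hh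
    have hm := (mul_eq_zero.1 (hmh j)).resolve_right hh
    obtain ⟨a, b, hab⟩ := H.coprime
    have := congrArg (aeval (η ^ j.val)) hab
    simp [hl, hm] at this
  have hmm := H.monic.map (algebraMap F K)
  have h0 : h ≠ 0 := (H.ne_zero_and_ne_zero hn).2
  refine (eq_of_monic_of_dvd_of_natDegree_le (rootPoly_monic _ _) hmm h1 ?_)
  have hd2 := natDegree_le_of_dvd h2 ((Polynomial.map_ne_zero_iff (algebraMap F K).injective).2 h0)
  have hd : (m * h).natDegree = n := by rw [H.mul_eq]; exact natDegree_X_pow_sub_one n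
  rw [H.monic.natDegree_mul' h0] at hd
  rw [natDegree_rootPoly, natDegree_map] at *
  have := Finset.card_add_card_compl S
  rw [ZMod.card] at this
  omega

end RootPoly

/-! ### Cyclic codes: dimension, and membership through the Fourier transform -/

section Code

variable {F : Type*} [Field F] {n : ℕ}

theorem wordPoly_apply (c : Fin n → F) : wordPoly n c = ∑ i : Fin n, monomial (i : ℕ) (c i) := by
  simp [wordPoly]

theorem wordPoly_coeff_fin (f : F[X]) (hf : f.natDegree < n) :
    wordPoly n (fun i => f.coeff i) = f := by
  rw [wordPoly_apply, Fin.sum_univ_eq_sum_range (fun i => monomial i (f.coeff i))]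
  exact (f.as_sum_range' n hf).symm

theorem mem_cyclicCode_iff_dvd {m : F[X]} (hm : m ∣ X ^ n - 1) {c : Fin n → F} :
    c ∈ cyclicCode n m ↔ m ∣ wordPoly n c := by
  have h : Ideal.span {m, (X : F[X]) ^ n - 1} = Ideal.span {m} := by
    rw [Ideal.span_insert, sup_eq_left, Ideal.span_singleton_le_span_singleton]
    exact hm
  rw [cyclicCode, Submodule.mem_comap, Submodule.restrictScalars_mem, h,
    Ideal.mem_span_singleton]

theorem finrank_cyclicCode {m : F[X]} (hn : 0 < n) (hm : m.Monic) (hdvd : m ∣ X ^ n - 1) :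
    Module.finrank F (cyclicCode n m) = n - m.natDegree := by
  -- The code is the kernel of a surjection onto F[x]/(m), a space of dimension deg m.
  let φ : (Fin n → F) →ₗ[F] AdjoinRoot m := (AdjoinRoot.mkₐ m).toLinearMap ∘ₗ wordPoly n
  have hker : LinearMap.ker φ = cyclicCode n m := by
    ext c
    rw [LinearMap.mem_ker, mem_cyclicCode_iff_dvd hdvd, ← AdjoinRoot.mk_eq_zero]
    rfl
  have hdeg : m.natDegree ≤ n := by
    have := natDegree_le_of_dvd hdvd (X_pow_sub_one_ne_zero hn.ne')
    rwa [natDegree_X_pow_sub_one] at this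
  have hsurj : LinearMap.range φ = ⊤ := by
    rw [LinearMap.range_eq_top]
    intro z
    obtain ⟨f, rfl⟩ := AdjoinRoot.mk_surjective z
    by_cases hm1 : m = 1
    · refine ⟨0, ?_⟩
      rw [map_zero, eq_comm, AdjoinRoot.mk_eq_zero, hm1]
      exact one_dvd _
    refine ⟨fun i => (f %ₘ m).coeff i, ?_⟩
    change AdjoinRoot.mk m (wordPoly n _) = _
    rw [wordPoly_coeff_fin _ ((natDegree_modByMonic_lt f hm hm1).trans_le hdeg),
      AdjoinRoot.mk_eq_mk]
    exact ⟨-(f /ₘ m), by linear_combination modByMonic_add_div f m⟩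
  have h1 := LinearMap.finrank_range_add_finrank_ker φ
  rw [hsurj, finrank_top, hker, Module.finrank_fin_fun, (AdjoinRoot.powerBasis' hm).finrank,
    AdjoinRoot.powerBasis'_dim] at h1
  omega

theorem exists_hasParameters {D : Submodule F (Fin n → F)} {k : ℕ} (hk : Module.finrank F D = k)
    (hk0 : k ≠ 0) : ∃ d, HasParameters D k d := by
  classical
  have hne : D ≠ ⊥ := by
    rintro rfl
    exact hk0 (by rw [← hk, finrank_bot])
  obtain ⟨c, hc, hc0⟩ := D.exists_mem_ne_zero_of_ne_bot hne
  exact ⟨_, hk, Nat.sInf_mem ⟨_, c, hc, hc0, rfl⟩, fun w hw => Nat.sInf_le hw⟩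

/-- The coordinates of words of length `n`, as residues modulo `n`. -/
def coordEquiv (n : ℕ) [NeZero n] : ZMod n ≃ Fin n where
  toFun x := ⟨x.val, x.val_lt⟩
  invFun i := ((i : ℕ) : ZMod n)
  left_inv x := ZMod.natCast_zmod_val x
  right_inv i := Fin.ext (ZMod.val_cast_of_lt i.2)

variable [NeZero n]

theorem card_filter_coordEquiv_ne_zero [DecidableEq F] (c : Fin n → F) :
    (Finset.univ.filter fun x : ZMod n => c (coordEquiv n x) ≠ 0).card = hammingNorm c := by
  rw [hammingNorm]
  refine Finset.card_equiv (coordEquiv n) fun x => ?_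
  simp

theorem mem_cyclicCode_iff_dft {K : Type*} [Field K] [Algebra F K] {η : K}
    (hη : IsPrimitiveRoot η n) {m : F[X]} {S : Finset (ZMod n)}
    (hm : m.map (algebraMap F K) = rootPoly η S) (hdvd : m ∣ X ^ n - 1) {c : Fin n → F} :
    c ∈ cyclicCode n m ↔ ∀ j ∈ S, ∑ x : ZMod n, algebraMap F K (c (coordEquiv n x)) *
      AddChar.zmodChar n hη.pow_eq_one (x * j) = 0 := by
  have heval : ∀ j : ZMod n, (wordPoly n c |>.map (algebraMap F K)).eval (η ^ j.val) =
      ∑ x : ZMod n, algebraMap F K (c (coordEquiv n x)) *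
      AddChar.zmodChar n hη.pow_eq_one (x * j) := by
    intro j
    rw [eval_map, wordPoly_apply, eval₂_finsetSum, ← (coordEquiv n).sum_comp]
    refine Finset.sum_congr rfl fun x _ => ?_
    rw [eval₂_monomial, AddChar.zmodChar_apply, ZMod.val_mul, ← pow_mul, mul_comm j.val]
    congr 1
    exact (pow_mod_orderOf η _).symm.trans (by rw [← hη.eq_orderOf]; rfl)
  rw [mem_cyclicCode_iff_dvd hdvd, ← map_dvd_map' (algebraMap F K), hm]
  constructor
  · intro h j hj
    rw [← heval]
    refine eval_eq_zero_of_dvd_of_eval_eq_zero h ?_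
    rw [rootPoly, eval_prod]
    exact Finset.prod_eq_zero hj (by simp)
  · intro h
    exact rootPoly_dvd hη fun j hj => by rw [heval, h j hj]

end Code

/-! ### Fourier transform on ℤ/n and the square root bound -/

section Fourier

variable {K : Type*} [Field K] {n : ℕ} [NeZero n] {ψ : AddChar (ZMod n) K}

theorem sum_dft_mul (hψ : ψ.IsPrimitive) (f : ZMod n → K) (z : ZMod n) :
    ∑ j, (∑ x, f x * ψ (x * j)) * ψ (-(z * j)) = n * f z := by
  simp_rw [Finset.sum_mul]
  rw [Finset.sum_comm]
  have : ∀ x, ∑ j, f x * ψ (x * j) * ψ (-(z * j)) = f x * ∑ j, ψ (j * (x - z)) := by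
    intro x
    rw [Finset.mul_sum]
    refine Finset.sum_congr rfl fun j _ => ?_
    rw [mul_assoc, ← AddChar.map_add_eq_mul]
    congr 2
    ring
  simp_rw [this, AddChar.sum_mulShift _ hψ, sub_eq_zero]
  simp [ZMod.card, mul_comm]

/-- Fourier inversion when only the zero frequency survives: n·f is then constant. -/
theorem natCast_mul_eq_sum_of_dft_eq_zero (hψ : ψ.IsPrimitive) {f : ZMod n → K}
    (hf : ∀ j ≠ 0, ∑ x, f x * ψ (x * j) = 0) (z : ZMod n) : n * f z = ∑ x, f x := by
  rw [← sum_dft_mul hψ, Finset.sum_eq_single 0]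
  · simp
  · intro j _ hj
    rw [hf j hj, zero_mul]
  · simp

theorem dft_const (hψ : ψ.IsPrimitive) (a : K) {j : ZMod n} (hj : j ≠ 0) :
    ∑ x, a * ψ (x * j) = 0 := by
  rw [← Finset.mul_sum, AddChar.sum_mulShift _ hψ, if_neg hj]
  simp

theorem dft_convolution (f h : ZMod n → K) (j : ZMod n) :
    ∑ z, (∑ x, f x * h (z - x)) * ψ (z * j) =
      (∑ x, f x * ψ (x * j)) * ∑ x, h x * ψ (x * j) := by
  simp_rw [Finset.sum_mul]
  rw [Finset.sum_comm]
  refine Finset.sum_congr rfl fun x _ => ?_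
  rw [Finset.mul_sum, ← Equiv.sum_comp (Equiv.addRight x)]
  refine Finset.sum_congr rfl fun y _ => ?_
  simp only [Equiv.coe_addRight, add_sub_cancel_right, add_mul, AddChar.map_add_eq_mul]
  ring

open Classical in
/-- The square root bound. -/
theorem le_sq_card_support (hψ : ψ.IsPrimitive) {S T : Finset (ZMod n)}
    (hST : S ∪ T = Finset.univ.erase 0) {a : (ZMod n)ˣ} (ha : ∀ x ∈ T, (a : ZMod n) * x ∈ S)
    {f : ZMod n → K} (hf : ∀ j ∈ S, ∑ x, f x * ψ (x * j) = 0) (h0 : ∑ x, f x ≠ 0) :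
    n ≤ (Finset.univ.filter fun x => f x ≠ 0).card ^ 2 := by
  set h : ZMod n → K := fun x => f ((a⁻¹ : (ZMod n)ˣ) * x) with hh
  have hhs : ∀ j, ∑ x, h x * ψ (x * j) = ∑ x, f x * ψ (x * (a * j)) := by
    intro j
    rw [← Equiv.sum_comp (Units.mulLeft a)]
    refine Finset.sum_congr rfl fun x _ => ?_
    simp only [hh, Units.mulLeft_apply, Units.inv_mul_cancel_left]
    congr 2
    ring
  -- The transform of f vanishes on S and that of its multiplier image h on T, so their product
  -- vanishes off 0.
  have hconv : ∀ j ≠ 0, ∑ z, (∑ x, f x * h (z - x)) * ψ (z * j) = 0 := by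
    intro j hj
    have : j ∈ S ∪ T := by rw [hST]; simp [hj]
    rw [dft_convolution]
    rcases Finset.mem_union.1 this with hj | hj
    · rw [hf j hj, zero_mul]
    · rw [hhs, hf _ (ha j hj), mul_zero]
  have hne : ∀ z, ∑ x, f x * h (z - x) ≠ 0 := by
    intro z hz
    have h1 := natCast_mul_eq_sum_of_dft_eq_zero hψ hconv z
    have h2 := dft_convolution (ψ := ψ) f h 0
    have h3 := hhs 0
    simp only [mul_zero, AddChar.map_zero_eq_one, mul_one] at h2 h3
    rw [hz, mul_zero, h2, h3] at h1
    exact mul_ne_zero h0 h0 h1.symm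
  set A := Finset.univ.filter fun x => f x ≠ 0 with hA
  -- The convolution vanishes nowhere, so every residue is a sum of a point of A and a point of aA.
  have hcov : (Finset.univ : Finset (ZMod n)) ⊆
      (A ×ˢ A).image fun w => w.1 + a * w.2 := by
    intro z _
    obtain ⟨x, -, hx⟩ := Finset.exists_ne_zero_of_sum_ne_zero (hne z)
    refine Finset.mem_image.2 ⟨(x, (a⁻¹ : (ZMod n)ˣ) * (z - x)), ?_, ?_⟩
    · simpa [hA, hh] using hx
    · simp
  have := (Finset.card_le_card hcov).trans Finset.card_image_le
  rwa [Finset.card_univ, ZMod.card, Finset.card_product, ← sq] at this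

end Fourier

/-- The arithmetic of the moment method for a nonzero symbol: r is the number of words, A and B are
the first and second moments of the symbol count, and f is the count in the chosen word. The
Cauchy–Schwarz inequality `h` becomes a bound on the deviation of f after multiplying by M and
completing the square. -/
theorem sq_le_of_variance_ne_zero {q r n M A B f : ℝ} (hn : 0 < n) (hr : r = n * M + 1)
    (hA : q * A = n * r) (hB : q ^ 2 * B = q * (n * r) + n * (n - 1) * r)
    (hM : M = 1 ∨ 2 ≤ M) (hq : 2 ≤ q) (h : (A - n * f) ^ 2 ≤ (r - 1 - n) * (B - n * f ^ 2)) :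
    (q * M * f - r) ^ 2 ≤ (q - 1) ^ 2 * (M - 1) ^ 2 * r := by
  have h1 : n ^ 2 * (r - q * f) ^ 2 ≤
      n ^ 2 * ((M - 1) * (q * r + (n - 1) * r - (q * f) ^ 2)) := by
    have e1 : n ^ 2 * (r - q * f) ^ 2 = q ^ 2 * (A - n * f) ^ 2 := by
      rw [← mul_pow, ← mul_pow, mul_sub q, hA]; ring
    have e2 : n ^ 2 * ((M - 1) * (q * r + (n - 1) * r - (q * f) ^ 2)) =
        q ^ 2 * ((r - 1 - n) * (B - n * f ^ 2)) := by
      have : q ^ 2 * (B - n * f ^ 2) = n * (q * r + (n - 1) * r - (q * f) ^ 2) := by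
        rw [mul_sub, hB]; ring
      rw [mul_left_comm (q ^ 2), this, hr]; ring
    rw [e1, e2]
    exact mul_le_mul_of_nonneg_left h (sq_nonneg q)
  have h2 := le_of_mul_le_mul_left h1 (by positivity)
  have hM0 : 0 ≤ M := by rcases hM with h | h <;> linarith
  have hr0 : 0 ≤ r := by rw [hr]; positivity
  have h3 : (q * M * f - r) ^ 2 ≤ (M - 1) * r * (M * (q - 1) - 1) := by
    have := mul_le_mul_of_nonneg_left h2 hM0
    have e : M * (n - 1) * r = (r - 1 - M) * r := by rw [hr]; ring
    nlinarith
  refine h3.trans ?_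
  -- The difference of the sides is (M-1)((q-2)((q-1)(M-1)-1)), which is negative for q > 2 and M
  -- slightly above 1; hence the gap required by `hM`.
  have h4 : (M - 1) * (M * (q - 1) - 1) ≤ (q - 1) ^ 2 * (M - 1) ^ 2 := by
    rcases hM with rfl | hM
    · simp
    · have : 0 ≤ (M - 1) * ((q - 2) * ((q - 1) * (M - 1) - 1)) := by
        refine mul_nonneg (by linarith) (mul_nonneg (by linarith) ?_)
        nlinarith
      nlinarith
  nlinarith

/-- The analogue for the symbol 0, where the zero word contributes n to A and n² to B and must be
removed as well. -/
theorem sq_le_of_variance_zero {q r n M A B f : ℝ} (hn : 0 < n) (hr : r = n * M + 1)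
    (hA : q * A = n * r) (hB : q ^ 2 * B = q * (n * r) + n * (n - 1) * r)
    (hM : 1 ≤ M) (hq : 2 ≤ q)
    (h : (A - n - n * f) ^ 2 ≤ (r - 1 - n) * (B - n ^ 2 - n * f ^ 2)) :
    (q * M * f - (r - q)) ^ 2 ≤ (q - 1) ^ 2 * (M - 1) ^ 2 * r := by
  have h1 : n ^ 2 * (r - q - q * f) ^ 2 ≤
      n ^ 2 * ((M - 1) * (q * r + (n - 1) * r - q ^ 2 * n - (q * f) ^ 2)) := by
    have e1 : n ^ 2 * (r - q - q * f) ^ 2 = q ^ 2 * (A - n - n * f) ^ 2 := by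
      rw [← mul_pow, ← mul_pow, mul_sub q, mul_sub q, hA]; ring
    have e2 : n ^ 2 * ((M - 1) * (q * r + (n - 1) * r - q ^ 2 * n - (q * f) ^ 2)) =
        q ^ 2 * ((r - 1 - n) * (B - n ^ 2 - n * f ^ 2)) := by
      have : q ^ 2 * (B - n ^ 2 - n * f ^ 2) =
          n * (q * r + (n - 1) * r - q ^ 2 * n - (q * f) ^ 2) := by
        rw [mul_sub, mul_sub, hB]; ring
      rw [mul_left_comm (q ^ 2), this, hr]; ring
    rw [e1, e2]
    exact mul_le_mul_of_nonneg_left h (sq_nonneg q)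
  have h2 := le_of_mul_le_mul_left h1 (by positivity)
  have hr0 : 0 ≤ r := by rw [hr]; nlinarith
  have h3 : (q * M * f - (r - q)) ^ 2 ≤ (M - 1) * r * ((q - 1) * (M - (q - 1))) := by
    have := mul_le_mul_of_nonneg_left h2 (by linarith : 0 ≤ M)
    have e : M * n = r - 1 := by rw [hr]; ring
    have e' : M * ((M - 1) * (q * r + (n - 1) * r - q ^ 2 * n - (q * f) ^ 2)) =
      (M - 1) * (M * q * r + (r - 1) * r - M * r - q ^ 2 * (r - 1) - M * (q * f) ^ 2) := by
      rw [← e]; ring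
    rw [e'] at this
    nlinarith
  refine h3.trans ?_
  have h4 : (M - 1) * ((q - 1) * (M - (q - 1))) ≤ (q - 1) ^ 2 * (M - 1) ^ 2 := by
    have : 0 ≤ (M - 1) * ((q - 1) * (M * (q - 2))) :=
      mul_nonneg (by linarith) (mul_nonneg (by linarith) (mul_nonneg (by linarith) (by linarith)))
    nlinarith
  nlinarith

/-! ### Symbol counts in shift-invariant codes and the weight bound -/

section Weights

variable {F : Type*} [Field F] [Fintype F] {n : ℕ} [Fact n.Prime]
  {E : Submodule F (ZMod n → F)}

/-- The number of coordinates where a word takes the value `e`. -/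
noncomputable def valueCount (e : F) (b : ZMod n → F) : ℕ :=
  open Classical in (Finset.univ.filter fun x => b x = e).card

omit [Fintype F] in
theorem eq_of_periodic {M : Type*} {b : ZMod n → M} {s : ZMod n} (hs : s ≠ 0)
    (h : ∀ t, b (t + s) = b t) (x y : ZMod n) : b x = b y := by
  have hk : ∀ k : ℕ, b (y + k * s) = b y := by
    intro k
    induction k with
    | zero => simp
    | succ k ih => rw [← ih, ← h (y + k * s)]; congr 1; push_cast; ring
  rw [← hk ((x - y) / s).val, ZMod.natCast_zmod_val, div_mul_cancel₀ _ hs]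
  congr 1
  ring

variable (hshift : ∀ b ∈ E, ∀ t : ZMod n, (fun x => b (x + t)) ∈ E)
  (hconst : ∀ a : F, (fun _ => a) ∈ E → a = 0) (hq : ¬ n ∣ Fintype.card F - 1)

include hshift hconst hq

/-- A linear relation between two coordinates would, by shift invariance, make each word geometric
along the step y-x. Its ratio is an nth root of unity in F, hence 1 because n does not divide q-1;
the word is then constant and so zero. -/
theorem eval_pair_surjective (hE : E ≠ ⊥) {x y : ZMod n} (hxy : x ≠ y) :
    Function.Surjective (((LinearMap.proj x).prod (LinearMap.proj y) :
      (ZMod n → F) →ₗ[F] F × F) ∘ₗ E.subtype) := by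
  rw [← LinearMap.range_eq_top]
  by_contra hne
  obtain ⟨φ, hφ0, hφ⟩ := Submodule.exists_le_ker_of_lt_top _ (lt_top_iff_ne_top.2 hne)
  have hφ' : ∀ s t, φ (s, t) = s * φ (1, 0) + t * φ (0, 1) := by
    intro s t
    have : (s, t) = s • ((1 : F), (0 : F)) + t • ((0 : F), (1 : F)) := by simp
    rw [this, map_add, map_smul, map_smul, smul_eq_mul, smul_eq_mul]
  have hrel : ∀ b ∈ E, ∀ t, b t * φ (1, 0) + b (t + (y - x)) * φ (0, 1) = 0 := by
    intro b hb t
    have := hφ ⟨⟨_, hshift b hb (t - x)⟩, rfl⟩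
    replace this : φ (b (x + (t - x)), b (y + (t - x))) = 0 := this
    rw [hφ'] at this
    convert this using 4 <;> ring
  have hs : y - x ≠ 0 := sub_ne_zero.2 hxy.symm
  obtain ⟨b, hb, hb0⟩ := E.exists_mem_ne_zero_of_ne_bot hE
  obtain ⟨t, ht⟩ := Function.ne_iff.1 hb0
  simp only [Pi.zero_apply] at ht
  by_cases hβ : φ (0, 1) = 0
  · have hα : φ (1, 0) = 0 := by
      have := hrel b hb t
      rw [hβ, mul_zero, add_zero] at this
      exact (mul_eq_zero.1 this).resolve_left ht
    apply hφ0
    ext <;> simp [hα, hβ]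
  set γ := -φ (1, 0) / φ (0, 1) with hγ
  have hstep : ∀ t, b (t + (y - x)) = γ * b t := by
    intro t
    rw [hγ]
    field_simp
    linear_combination hrel b hb t
  have hpow : ∀ k : ℕ, b (t + k * (y - x)) = γ ^ k * b t := by
    intro k
    induction k with
    | zero => simp
    | succ k ih =>
      rw [pow_succ', mul_assoc, ← ih, ← hstep]
      congr 1
      push_cast
      ring
  have hγn : γ ^ n = 1 := by
    have := hpow n
    rw [CharP.cast_eq_zero, zero_mul, add_zero] at this
    exact mul_right_cancel₀ ht (this.symm.trans (one_mul _).symm)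
  have hγ1 : γ = 1 := by
    have hγ0 : γ ≠ 0 := by
      intro h
      rw [h, zero_pow (NeZero.ne n)] at hγn
      exact zero_ne_one hγn
    have hcop : Nat.Coprime n (Fintype.card F - 1) :=
      ((Fact.out : n.Prime).coprime_iff_not_dvd).2 hq
    have := orderOf_dvd_of_pow_eq_one hγn
    have h2 := orderOf_dvd_of_pow_eq_one (FiniteField.pow_card_sub_one_eq_one γ hγ0)
    have h1 := Nat.dvd_gcd this h2
    rw [Nat.Coprime] at hcop
    rw [hcop, Nat.dvd_one] at h1
    exact orderOf_eq_one_iff.1 h1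
  have hcst := eq_of_periodic hs (fun t => by rw [hstep, hγ1, one_mul] : ∀ t, b (t + (y - x)) = b t)
  refine ht (hconst _ ?_)
  have : (fun _ => b t) = b := funext fun z => hcst t z
  rwa [this]

omit [Fintype F] hshift hconst hq in
theorem card_mul_card_fiber {A B : Type*} [AddCommGroup A] [AddCommGroup B] [Fintype A]
    [Fintype B] [DecidableEq B] (f : A →+ B) (hf : Function.Surjective f) (y : B) :
    Fintype.card B * (Finset.univ.filter fun a => f a = y).card = Fintype.card A := by
  have h : ∀ z : B, (Finset.univ.filter fun a => f a = z).card =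
      (Finset.univ.filter fun a => f a = y).card := fun z =>
    AddMonoidHom.card_fiber_eq_of_mem_range f (hf z) (hf y)
  have := Finset.card_eq_sum_card_fiberwise (s := (Finset.univ : Finset A))
    (t := (Finset.univ : Finset B)) (f := f) (fun _ _ => Finset.mem_coe.2 (Finset.mem_univ _))
  simp_rw [h] at this
  rw [Finset.sum_const, smul_eq_mul, Finset.card_univ, Finset.card_univ] at this
  exact this.symm

open Classical in
theorem card_mul_sum_valueCount (hE : E ≠ ⊥) (e : F) :
    Fintype.card F * ∑ b : E, valueCount e (b : ZMod n → F) = n * Fintype.card E := by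
  have h1 : ∀ x : ZMod n,
      Fintype.card F * (Finset.univ.filter fun b : E => b.1 x = e).card = Fintype.card E := by
    intro x
    have hx : x ≠ x + 1 := by simp
    have hs := eval_pair_surjective hshift hconst hq hE hx
    let φ : E →+ F := ((LinearMap.proj x : (ZMod n → F) →ₗ[F] F) ∘ₗ E.subtype).toAddMonoidHom
    refine card_mul_card_fiber φ (fun z => ?_) e
    obtain ⟨b, hb⟩ := hs (z, 0)
    exact ⟨b, congrArg Prod.fst hb⟩
  have h2 : ∑ b : E, valueCount e (b : ZMod n → F) =
      ∑ x : ZMod n, (Finset.univ.filter fun b : E => b.1 x = e).card := by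
    simp_rw [valueCount, Finset.card_filter]
    exact Finset.sum_comm
  rw [h2, Finset.mul_sum, Finset.sum_congr rfl fun x _ => h1 x]
  simp [ZMod.card]

-- Squaring the count sums over pairs of positions. The n diagonal pairs contribute |E|/q each and
-- the n(n-1) others |E|/q², by joint equidistribution.
open Classical in
theorem card_sq_mul_sum_valueCount_sq (hE : E ≠ ⊥) (e : F) :
    Fintype.card F ^ 2 * ∑ b : E, valueCount e (b : ZMod n → F) ^ 2 =
      Fintype.card F * (n * Fintype.card E) + n * (n - 1) * Fintype.card E := by
  have h1 : ∀ x y : ZMod n, x ≠ y → Fintype.card F ^ 2 *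
      (Finset.univ.filter fun b : E => b.1 x = e ∧ b.1 y = e).card = Fintype.card E := by
    intro x y hxy
    have := card_mul_card_fiber (((LinearMap.proj x).prod (LinearMap.proj y) :
      (ZMod n → F) →ₗ[F] F × F) ∘ₗ E.subtype).toAddMonoidHom
      (eval_pair_surjective hshift hconst hq hE hxy) (e, e)
    rw [Fintype.card_prod, ← sq] at this
    rw [← this]
    congr 3
    ext b
    simp [Prod.ext_iff]
  have h2 : ∑ b : E, valueCount e (b : ZMod n → F) ^ 2 =
      ∑ x : ZMod n, ∑ y : ZMod n,
        (Finset.univ.filter fun b : E => b.1 x = e ∧ b.1 y = e).card := by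
    simp_rw [valueCount, sq, Finset.card_filter, Finset.sum_mul_sum]
    rw [Finset.sum_comm]
    refine Finset.sum_congr rfl fun x _ => ?_
    rw [Finset.sum_comm]
    refine Finset.sum_congr rfl fun y _ => Finset.sum_congr rfl fun b _ => ?_
    by_cases hx : b.1 x = e <;> by_cases hy : b.1 y = e <;> simp [hx, hy]
  have h3 : ∀ x : ZMod n, Fintype.card F ^ 2 * ∑ y : ZMod n,
        (Finset.univ.filter fun b : E => b.1 x = e ∧ b.1 y = e).card =
      Fintype.card F ^ 2 * (Finset.univ.filter fun b : E => b.1 x = e).card +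
        (n - 1) * Fintype.card E := by
    intro x
    rw [← Finset.add_sum_erase _ _ (Finset.mem_univ x), mul_add, Finset.mul_sum,
      Finset.sum_congr rfl fun y hy => h1 x y (Finset.ne_of_mem_erase hy).symm]
    simp [Finset.card_erase_of_mem, ZMod.card]
  rw [h2, Finset.mul_sum, Finset.sum_congr rfl fun x _ => h3 x, Finset.sum_add_distrib,
    ← Finset.mul_sum]
  have h4 : ∑ x : ZMod n, (Finset.univ.filter fun b : E => b.1 x = e).card =
      ∑ b : E, valueCount e (b : ZMod n → F) := by
    simp_rw [valueCount, Finset.card_filter]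
    exact Finset.sum_comm
  rw [h4, sq, mul_assoc, card_mul_sum_valueCount hshift hconst hq hE e]
  simp [ZMod.card, mul_assoc]

omit [Field F] [Fintype F] hshift hconst hq in
theorem valueCount_shift (e : F) (b : ZMod n → F) (t : ZMod n) :
    valueCount e (fun x => b (x + t)) = valueCount e b := by
  classical
  exact Finset.card_equiv (Equiv.addRight t) fun x => by simp

omit [Fintype F] hshift hconst hq in
theorem valueCount_zero_of_ne {e : F} (he : e ≠ 0) : valueCount e (0 : ZMod n → F) = 0 := by
  simp [valueCount, he.symm]

omit hq in
open Classical in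
/-- Cauchy–Schwarz for the words outside the cyclic orbit of `b₀`. -/
theorem sq_sum_valueCount_sub_le (e : F) {b₀ : ZMod n → F} (hb₀ : b₀ ∈ E) (h0 : b₀ ≠ 0) :
    n + 1 ≤ Fintype.card E ∧
    ((∑ b : E, valueCount e (b : ZMod n → F) : ℝ) - valueCount e (0 : ZMod n → F) -
      n * valueCount e b₀) ^ 2 ≤ (Fintype.card E - 1 - n) *
      ((∑ b : E, (valueCount e (b : ZMod n → F) : ℝ) ^ 2) -
        (valueCount e (0 : ZMod n → F) : ℝ) ^ 2 - n * (valueCount e b₀ : ℝ) ^ 2) := by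
  let sh : ZMod n → E := fun t => ⟨_, hshift b₀ hb₀ t⟩
  have hinj : Function.Injective sh := by
    intro s t hst
    by_contra hne
    have hper : ∀ x, b₀ (x + (s - t)) = b₀ x := by
      intro x
      have := congrFun (congrArg Subtype.val hst) (x - t)
      simp only [sh, sub_add_cancel] at this
      rw [← this]
      congr 1
      ring
    have hc := eq_of_periodic (sub_ne_zero.2 hne) hper
    have hb : (fun _ => b₀ 0) = b₀ := funext fun z => hc 0 z
    have := hconst (b₀ 0) (hb ▸ hb₀)
    exact h0 (by rw [← hb, this]; rfl)
  have hsh0 : ∀ t, sh t ≠ 0 := by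
    intro t h
    apply h0
    funext x
    have := congrFun (congrArg Subtype.val h) (x - t)
    simpa [sh] using this
  -- The excluded words: zero and the n shifts of b₀, which are distinct since a word with a nonzero
  -- period is constant. Cauchy–Schwarz is applied to the complement.
  set O : Finset E := insert 0 (Finset.univ.image sh) with hO
  have hOcard : O.card = n + 1 := by
    rw [hO, Finset.card_insert_of_notMem (by simpa using hsh0),
      Finset.card_image_of_injective _ hinj, Finset.card_univ, ZMod.card]
  have hOsum : ∀ f : ℕ → ℝ, ∑ b ∈ O, f (valueCount e (b : ZMod n → F)) =
      f (valueCount e (0 : ZMod n → F)) + n * f (valueCount e b₀) := by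
    intro f
    rw [hO, Finset.sum_insert (by simpa using hsh0), Finset.sum_image fun _ _ _ _ h => hinj h]
    have : ∀ t, valueCount e (sh t : ZMod n → F) = valueCount e b₀ := fun t =>
      valueCount_shift e b₀ t
    simp [this, ZMod.card]
  refine ⟨hOcard ▸ Finset.card_le_univ O, ?_⟩
  have hcs := sq_sum_le_card_mul_sum_sq (s := Oᶜ)
    (f := fun b : E => (valueCount e (b : ZMod n → F) : ℝ))
  have hs1 := Finset.sum_add_sum_compl O fun b : E => (valueCount e (b : ZMod n → F) : ℝ)
  have hs2 := Finset.sum_add_sum_compl O fun b : E => (valueCount e (b : ZMod n → F) : ℝ) ^ 2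
  have hc : (O.card : ℝ) + (Oᶜ.card : ℝ) = Fintype.card E := by
    exact_mod_cast Finset.card_add_card_compl O
  rw [hOcard] at hc
  push_cast at hc
  rw [hOsum fun k => (k : ℝ)] at hs1
  rw [hOsum fun k => (k : ℝ) ^ 2] at hs2
  rw [← hs1, ← hs2, ← hc]
  refine (le_of_eq ?_).trans (hcs.trans_eq ?_) <;> ring

open Classical in
theorem valueCount_le {N : ℕ} (hN : Fintype.card E = n * N + 1) (e : F) {b₀ : ZMod n → F}
    (hb₀ : b₀ ∈ E) (h0 : b₀ ≠ 0) :
    1 ≤ N ∧ Fintype.card F * N * (valueCount e b₀ : ℝ) ≤ Fintype.card E +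
      (Fintype.card F - 1) * ((N - 1) * √(Fintype.card E)) := by
  have hE : E ≠ ⊥ := by
    rintro rfl
    exact h0 ((Submodule.mem_bot F).1 hb₀)
  obtain ⟨hle, hcs⟩ := sq_sum_valueCount_sub_le hshift hconst e hb₀ h0
  have hn0 : 0 < n := (Fact.out : n.Prime).pos
  have hN1 : 1 ≤ N := by
    rw [hN] at hle
    by_contra h
    have : N = 0 := by omega
    subst this
    omega
  refine ⟨hN1, ?_⟩
  have hs1 := card_mul_sum_valueCount hshift hconst hq hE e
  have hs2 := card_sq_mul_sum_valueCount_sq hshift hconst hq hE e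
  have hq2 : 2 ≤ Fintype.card F := Fintype.one_lt_card
  have hz : valueCount e (0 : ZMod n → F) = if e = 0 then n else 0 := by
    by_cases he : e = 0
    · simp [valueCount, he, ZMod.card]
    · rw [valueCount_zero_of_ne he, if_neg he]
  rw [hz] at hcs
  push_cast at hcs
  replace hs1 := congrArg (Nat.cast (R := ℝ)) hs1
  replace hs2 := congrArg (Nat.cast (R := ℝ)) hs2
  push_cast [Nat.cast_sub (show 1 ≤ n from hn0)] at hs1 hs2
  have hNr : (Fintype.card E : ℝ) = n * N + 1 := by exact_mod_cast hN
  have hnR : (0 : ℝ) < n := by exact_mod_cast hn0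
  have hN1R : (1 : ℝ) ≤ N := by exact_mod_cast hN1
  have hqR : (2 : ℝ) ≤ Fintype.card F := by exact_mod_cast hq2
  have hNN : (N : ℝ) = 1 ∨ (2 : ℝ) ≤ N := by
    rcases hN1.eq_or_lt with h | h
    · left; exact_mod_cast h.symm
    · right; exact_mod_cast h
  generalize (∑ b : E, (valueCount e (b : ZMod n → F) : ℝ)) = A at *
  generalize (∑ b : E, (valueCount e (b : ZMod n → F) : ℝ) ^ 2) = B at *
  generalize (Fintype.card E : ℝ) = r at *
  generalize (valueCount e b₀ : ℝ) = f at *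
  generalize (Fintype.card F : ℝ) = q at *
  generalize hn' : (n : ℝ) = n' at *
  generalize (N : ℝ) = M at *
  have hr0 : 0 ≤ r := by rw [hNr]; positivity
  have hprod : 0 ≤ (q - 1) * ((M - 1) * √r) :=
    mul_nonneg (by linarith) (mul_nonneg (by linarith) (Real.sqrt_nonneg r))
  by_cases he : e = 0
  · rw [if_pos he] at hcs
    have := sq_le_of_variance_zero hnR hNr hs1 hs2 hN1R hqR hcs
    have := abs_le_of_sq_le_sq' (this.trans_eq
      (by rw [mul_pow, mul_pow, Real.sq_sqrt hr0]; ring :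
        _ = ((q - 1) * ((M - 1) * √r)) ^ 2)) hprod
    linarith [this.2]
  · rw [if_neg he] at hcs
    have := sq_le_of_variance_ne_zero hnR hNr hs1 hs2 hNN hqR (by simpa using hcs)
    have := abs_le_of_sq_le_sq' (this.trans_eq
      (by rw [mul_pow, mul_pow, Real.sq_sqrt hr0]; ring :
        _ = ((q - 1) * ((M - 1) * √r)) ^ 2)) hprod
    linarith [this.2]

-- A word of D is a constant a plus a word b of the zero-sum subcode E, so its zeros are the
-- positions where b equals -a. E has codimension one in D and contains no nonzero constant, because
-- n is invertible in F.
omit hshift hconst in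
theorem weight_bound {D : Submodule F (ZMod n → F)}
    (hshift : ∀ b ∈ D, ∀ t : ZMod n, (fun x => b (x + t)) ∈ D)
    (hconst : ∀ a : F, (fun _ => a) ∈ D) (hnF : (n : F) ≠ 0) {k N : ℕ}
    (hk : Module.finrank F D = k + 1) (hN : Fintype.card F ^ k = n * N + 1) (hN0 : N ≠ 0)
    [DecidableEq F] {c : ZMod n → F} (hc : c ∈ D) (hc0 : c ≠ 0) :
    (((Fintype.card F : ℝ) - 1) * ((Fintype.card F : ℝ) ^ k - 1) - 1) / (Fintype.card F * N) -
      ((Fintype.card F : ℝ) - 1) / Fintype.card F *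
        ((N - 1) * √((Fintype.card F : ℝ) ^ k) / N) ≤
      (Finset.univ.filter fun x => c x ≠ 0).card := by
  classical
  let σ : (ZMod n → F) →ₗ[F] F := ∑ x, LinearMap.proj x
  have hσ : ∀ b, σ b = ∑ x, b x := fun b => by simp [σ]
  set E : Submodule F (ZMod n → F) := (LinearMap.ker (σ ∘ₗ D.subtype)).map D.subtype with hE
  have hmemE : ∀ b, b ∈ E ↔ b ∈ D ∧ ∑ x, b x = 0 := by
    intro b
    simp only [hE, Submodule.mem_map, LinearMap.mem_ker, LinearMap.comp_apply,
      Submodule.subtype_apply, hσ]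
    exact ⟨fun ⟨y, hy, hyb⟩ => hyb ▸ ⟨y.2, hy⟩, fun ⟨h1, h2⟩ => ⟨⟨b, h1⟩, h2, rfl⟩⟩
  have hEk : Module.finrank F E = k := by
    rw [hE, Submodule.finrank_map_subtype_eq]
    have hsurj : LinearMap.range (σ ∘ₗ D.subtype) = ⊤ := by
      rw [LinearMap.range_eq_top]
      intro a
      refine ⟨⟨_, hconst (a / n)⟩, ?_⟩
      simp only [LinearMap.comp_apply, Submodule.subtype_apply, hσ]
      simp [ZMod.card, mul_div_cancel₀ _ hnF]
    have := LinearMap.finrank_range_add_finrank_ker (σ ∘ₗ D.subtype)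
    rw [hsurj, finrank_top, Module.finrank_self, hk] at this
    omega
  have hEcard : Fintype.card E = Fintype.card F ^ k := by
    rw [Module.card_eq_pow_finrank (K := F), hEk]
  have hEshift : ∀ b ∈ E, ∀ t : ZMod n, (fun x => b (x + t)) ∈ E := by
    intro b hb t
    rw [hmemE] at hb ⊢
    exact ⟨hshift b hb.1 t, by rw [← hb.2]; exact Equiv.sum_comp (Equiv.addRight t) b⟩
  have hEconst : ∀ a : F, (fun _ => a) ∈ E → a = 0 := by
    intro a ha
    have := ((hmemE _).1 ha).2
    simpa [ZMod.card, hnF] using this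
  have hq2 : (2 : ℝ) ≤ Fintype.card F := by
    exact_mod_cast (Fintype.one_lt_card : 1 < Fintype.card F)
  have hN1 : (1 : ℝ) ≤ N := by exact_mod_cast Nat.one_le_iff_ne_zero.2 hN0
  have hr : (Fintype.card F : ℝ) ^ k = n * N + 1 := by exact_mod_cast hN
  set a : F := (∑ x, c x) / n with ha
  set b : ZMod n → F := fun x => c x - a with hb
  have hbE : b ∈ E := by
    rw [hmemE]
    refine ⟨D.sub_mem hc (hconst a), ?_⟩
    simp [hb, Finset.sum_sub_distrib, ZMod.card, ha, mul_div_cancel₀ _ hnF]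
  have hcount : ((Finset.univ.filter fun x => c x ≠ 0).card : ℝ) = n - valueCount (-a) b := by
    have h1 : valueCount (-a) b = (Finset.univ.filter fun x => c x = 0).card := by
      rw [valueCount]
      congr 1
      ext x
      simp only [hb, Finset.mem_filter]
      refine and_congr_right fun _ => ?_
      rw [sub_eq_neg_self]
    have h2 := Finset.card_filter_add_card_filter_not (s := (Finset.univ : Finset (ZMod n)))
      (fun x => c x = 0)
    rw [Finset.card_univ, ZMod.card] at h2
    rw [h1, eq_sub_iff_add_eq, add_comm]
    exact_mod_cast h2
  have hbound : (Fintype.card F : ℝ) * N * valueCount (-a) b ≤ (Fintype.card F : ℝ) ^ k +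
      ((Fintype.card F : ℝ) - 1) * ((N - 1) * √((Fintype.card F : ℝ) ^ k)) := by
    -- When b = 0 the word is a nonzero constant and has no zeros; the orbit argument needs b ≠ 0.
    by_cases hb0 : b = 0
    · have hane : -a ≠ 0 := by
        intro h0
        apply hc0
        funext x
        have := congrFun hb0 x
        simp only [hb, neg_eq_zero.1 h0, sub_zero] at this
        exact this
      have : valueCount (-a) b = 0 := by
        rw [hb0]
        exact valueCount_zero_of_ne hane
      rw [this, Nat.cast_zero, mul_zero]
      have := mul_nonneg (by linarith : (0 : ℝ) ≤ (Fintype.card F : ℝ) - 1) (mul_nonneg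
        (by linarith : (0 : ℝ) ≤ (N : ℝ) - 1) (Real.sqrt_nonneg ((Fintype.card F : ℝ) ^ k)))
      positivity
    · have := (valueCount_le hEshift hEconst hq (hEcard.trans hN) (-a) hbE hb0).2
      rw [hEcard] at this
      push_cast at this
      exact this
  rw [hcount]
  generalize (valueCount (-a) b : ℝ) = V at *
  generalize √((Fintype.card F : ℝ) ^ k) = w at *
  rw [hr] at hbound ⊢
  have hqN : (0 : ℝ) < Fintype.card F * N := by positivity
  have hne : (Fintype.card F : ℝ) ≠ 0 := by linarith
  have hNne : (N : ℝ) ≠ 0 := by linarith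
  have e : ((((Fintype.card F : ℝ) - 1) * ((n * N + 1 : ℝ) - 1) - 1) / (Fintype.card F * N) -
      ((Fintype.card F : ℝ) - 1) / Fintype.card F * ((N - 1) * w / N)) =
      (((Fintype.card F : ℝ) - 1) * (n * N) - 1 - ((Fintype.card F : ℝ) - 1) * ((N - 1) * w)) /
        (Fintype.card F * N) := by
    field_simp
    ring
  rw [e, div_le_iff₀ hqN]
  linarith

end Weights

/-- Rounding x down raises a-wx by less than 1, as w < 1; the outer floor absorbs this because d is
an integer. -/
theorem floor_sub_mul_floor_le {a w x : ℝ} {d : ℤ} (hw0 : 0 ≤ w) (hw1 : w < 1)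
    (h : a - w * x ≤ d) : ⌊a - w * ⌊x⌋⌋ ≤ d := by
  rw [← Int.lt_add_one_iff, Int.floor_lt]
  push_cast
  have h1 := Int.lt_floor_add_one x
  have h2 := Int.floor_le x
  nlinarith

/-! ### The bounds restated for cyclic codes -/

section CyclicCodes

variable {F K : Type*} [Field F] [Field K] [Algebra F K] {n : ℕ} [Fact n.Prime] {η : K}

theorem const_mem_cyclicCode (hη : IsPrimitiveRoot η n) {m : F[X]} {S : Finset (ZMod n)}
    (hm : m.map (algebraMap F K) = rootPoly η S) (hdvd : m ∣ X ^ n - 1) (h0 : (0 : ZMod n) ∉ S)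
    (a : F) : (fun _ => a) ∈ cyclicCode n m := by
  rw [mem_cyclicCode_iff_dft hη hm hdvd]
  intro j hj
  exact dft_const (AddChar.zmodChar_primitive_of_primitive_root n hη) _ fun h => h0 (h ▸ hj)

theorem hasParameters_repetition (hη : IsPrimitiveRoot η n) {m : F[X]} (hmm : m.Monic)
    [DecidableEq (ZMod n)]
    (hm : m.map (algebraMap F K) = rootPoly η ((Finset.univ : Finset (ZMod n)).erase 0))
    (hdvd : m ∣ X ^ n - 1) (hnF : (n : F) ≠ 0) : HasParameters (cyclicCode n m) 1 n := by
  classical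
  have hn : 1 < n := (Fact.out : n.Prime).one_lt
  have hdeg : m.natDegree = n - 1 := by
    rw [← natDegree_map (algebraMap F K), hm, natDegree_rootPoly,
      Finset.card_erase_of_mem (Finset.mem_univ _), Finset.card_univ, ZMod.card]
  refine ⟨by rw [finrank_cyclicCode (by omega) hmm hdvd, hdeg]; omega, ?_, ?_⟩
  · refine ⟨_, const_mem_cyclicCode hη hm hdvd (by simp) 1, ?_, ?_⟩
    · intro h
      simpa using congrFun h ⟨0, by omega⟩
    · simp [hammingNorm]
  · rintro w ⟨c, hc, hc0, rfl⟩
    rw [mem_cyclicCode_iff_dft hη hm hdvd] at hc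
    have hnK : (n : K) ≠ 0 := by
      rw [← map_natCast (algebraMap F K)]
      exact (_root_.map_ne_zero _).2 hnF
    have hcst := natCast_mul_eq_sum_of_dft_eq_zero
      (f := fun x => algebraMap F K (c (coordEquiv n x)))
      (AddChar.zmodChar_primitive_of_primitive_root n hη) fun j hj => hc j (by simp [hj])
    rw [← card_filter_coordEquiv_ne_zero, Finset.filter_true_of_mem, Finset.card_univ, ZMod.card]
    intro x _ hx
    apply hc0
    funext i
    obtain ⟨y, rfl⟩ := (coordEquiv n).surjective i
    have h1 := (hcst y).trans (hcst x).symm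
    simp only [hx, map_zero, mul_zero] at h1
    simpa using (mul_eq_zero.1 h1).resolve_left hnK

theorem exists_isMinOddLikeWeight (hη : IsPrimitiveRoot η n) {m : F[X]} {S T : Finset (ZMod n)}
    (hm : m.map (algebraMap F K) = rootPoly η S) (hdvd : m ∣ X ^ n - 1) (hnF : (n : F) ≠ 0)
    [DecidableEq (ZMod n)] (hST : S ∪ T = Finset.univ.erase 0) {a : (ZMod n)ˣ}
    (ha : ∀ x ∈ T, (a : ZMod n) * x ∈ S) :
    ∃ d : ℕ, IsMinOddLikeWeight (cyclicCode n m) d ∧ √(n : ℝ) ≤ d := by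
  classical
  have h0 : (0 : ZMod n) ∉ S := by
    intro h
    have : (0 : ZMod n) ∈ S ∪ T := Finset.mem_union_left _ h
    rw [hST] at this
    simp at this
  have hne : {w : ℕ | ∃ c ∈ cyclicCode n m, ∑ i, c i ≠ 0 ∧ hammingNorm c = w}.Nonempty :=
    ⟨_, _, const_mem_cyclicCode hη hm hdvd h0 1, by simpa using hnF, rfl⟩
  refine ⟨_, ⟨Nat.sInf_mem hne, fun w hw => Nat.sInf_le hw⟩, ?_⟩
  obtain ⟨c, hc, hcs, hw⟩ := Nat.sInf_mem hne
  rw [← hw]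
  rw [mem_cyclicCode_iff_dft hη hm hdvd] at hc
  have := le_sq_card_support (AddChar.zmodChar_primitive_of_primitive_root n hη)
    (f := fun x => algebraMap F K (c (coordEquiv n x)))
    (by convert hST) ha hc (by
      rw [← map_sum, (coordEquiv n).sum_comp]
      exact (_root_.map_ne_zero _).2 hcs)
  rw [Real.sqrt_le_left (by positivity), ← card_filter_coordEquiv_ne_zero]
  simp only [ne_eq, map_eq_zero] at this
  exact_mod_cast this

theorem cyclicCode_weight_bound [Fintype F] (hη : IsPrimitiveRoot η n) {m : F[X]}
    {S : Finset (ZMod n)} (hm : m.map (algebraMap F K) = rootPoly η S) (hdvd : m ∣ X ^ n - 1)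
    (h0 : (0 : ZMod n) ∉ S) (hnF : (n : F) ≠ 0) (hq : ¬ n ∣ Fintype.card F - 1) {k N : ℕ}
    (hk : Module.finrank F (cyclicCode n m) = k + 1) (hN : Fintype.card F ^ k = n * N + 1)
    (hN0 : N ≠ 0) [DecidableEq F] {c : Fin n → F} (hc : c ∈ cyclicCode n m) (hc0 : c ≠ 0) :
    (((Fintype.card F : ℝ) - 1) * ((Fintype.card F : ℝ) ^ k - 1) - 1) / (Fintype.card F * N) -
      ((Fintype.card F : ℝ) - 1) / Fintype.card F *
        ((N - 1) * √((Fintype.card F : ℝ) ^ k) / N) ≤ hammingNorm c := by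
  let e : (Fin n → F) ≃ₗ[F] (ZMod n → F) := LinearEquiv.funCongrLeft F F (coordEquiv n)
  have he : ∀ c x, e c x = c (coordEquiv n x) := fun _ _ => rfl
  set D := (cyclicCode n m).map e.toLinearMap with hD
  have hmemD : ∀ f : ZMod n → F, f ∈ D ↔ ∀ j ∈ S, ∑ x : ZMod n, algebraMap F K (f x) *
      AddChar.zmodChar n hη.pow_eq_one (x * j) = 0 := by
    intro f
    have : f ∈ D ↔ e.symm f ∈ cyclicCode n m := by
      rw [hD, Submodule.mem_map_equiv]
    rw [this, mem_cyclicCode_iff_dft hη hm hdvd]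
    simp_rw [← he, LinearEquiv.apply_symm_apply]
  have hshift : ∀ b ∈ D, ∀ t : ZMod n, (fun x => b (x + t)) ∈ D := by
    intro b hb t
    rw [hmemD] at hb ⊢
    intro j hj
    -- Shifting by t multiplies the transform at j by ψ(-tj), so its zeros are unchanged.
    rw [← mul_zero (AddChar.zmodChar n hη.pow_eq_one (-t * j)), ← hb j hj, Finset.mul_sum,
      ← Equiv.sum_comp (Equiv.addRight t) fun x => AddChar.zmodChar n hη.pow_eq_one (-t * j) *
        (algebraMap F K (b x) * AddChar.zmodChar n hη.pow_eq_one (x * j))]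
    refine Finset.sum_congr rfl fun x _ => ?_
    rw [mul_left_comm, ← AddChar.map_add_eq_mul, Equiv.coe_addRight]
    congr 2
    ring
  have hconst : ∀ a : F, (fun _ => a) ∈ D := by
    intro a
    rw [hmemD]
    intro j hj
    exact dft_const (AddChar.zmodChar_primitive_of_primitive_root n hη) _ fun h => h0 (h ▸ hj)
  have hkD : Module.finrank F D = k + 1 := by
    rw [hD, ← hk]
    exact e.finrank_map_eq _
  have hcD : e c ∈ D := Submodule.mem_map_of_mem hc
  have hc0' : e c ≠ 0 := by simpa using hc0
  have := weight_bound hq hshift hconst hnF hkD hN hN0 hcD hc0'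
  simp only [he] at this
  rwa [card_filter_coordEquiv_ne_zero] at this

end CyclicCodes

/-! ### Values of Λ and Γ as sums of periods -/

section CycSeq

variable {F K : Type*} [Field F] [Field K] [Algebra F K] {n : ℕ} [Fact n.Prime] {η : K}
  {g : (ZMod n)ˣ}

theorem cycSeq_add (i : ℕ) : cycSeq F g (i + n) = cycSeq F g i := by
  simp [cycSeq]

omit [Fact n.Prime] in
theorem coordEquiv_val [NeZero n] (x : ZMod n) : (coordEquiv n x : ℕ) = x.val := rfl

theorem sum_cycSeq : ∑ i ∈ Finset.range n, C (cycSeq F g i) * X ^ i = Lam F g := by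
  classical
  rw [← Fin.sum_univ_eq_sum_range (fun i => C (cycSeq F g i) * X ^ i), ← (coordEquiv n).sum_comp,
    Lam, setPoly, ← Finset.sum_subset (Finset.subset_univ (cycClass g 0 ∪ cycClass g 1))]
  · refine Finset.sum_congr rfl fun x hx => ?_
    rw [cycSeq, coordEquiv_val, ZMod.natCast_zmod_val, if_pos hx, C_1, one_mul]
  · intro x _ hx
    rw [cycSeq, coordEquiv_val, ZMod.natCast_zmod_val, if_neg hx, C_0, zero_mul]


variable (hn4 : n % 4 = 1) (hg : ∀ x : (ZMod n)ˣ, x ∈ Subgroup.zpowers g)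

include hn4 hg

theorem disjoint_cycClass {i j : ℕ} (h : i % 4 ≠ j % 4) :
    Disjoint (cycClass g i) (cycClass g j) :=
  Finset.disjoint_left.2 fun _ hi hj => h (mod_eq_of_mem_cycClass hn4 hg hi hj)

theorem image_mul_cycClass [DecidableEq (ZMod n)] {x : ZMod n} {i k : ℕ}
    (hx : x ∈ cycClass g i) :
    (cycClass g k).image (fun y => x * y) = cycClass g (i + k) := by
  have hx0 : x ≠ 0 := fun h => zero_notMem_cycClass i (h ▸ hx)
  refine Finset.eq_of_subset_of_card_le ?_ ?_
  · intro y hy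
    obtain ⟨z, hz, rfl⟩ := Finset.mem_image.1 hy
    exact mul_mem_cycClass hn4 hg hx hz
  · rw [Finset.card_image_of_injective _ (mul_right_injective₀ hx0), card_cycClass hn4 hg,
      card_cycClass hn4 hg]

theorem period_congr {i j : ℕ} (h : i % 4 = j % 4) : period η g i = period η g j := by
  rw [period, period, cycClass_congr hn4 hg h]

/-- Multiplication by an element of C_i moves C_a to C_{i+a}, so replacing η by η^j only shifts the
indices of the periods. -/
theorem aeval_setPoly_union [DecidableEq (ZMod n)] (hη : IsPrimitiveRoot η n) {j : ZMod n}
    {i a b : ℕ} (hj : j ∈ cycClass g i) (hab : a % 4 ≠ b % 4) :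
    aeval (η ^ j.val) (setPoly F (cycClass g a ∪ cycClass g b)) =
      period η g (i + a) + period η g (i + b) := by
  have hx : ∀ x : ZMod n, (η ^ j.val) ^ x.val = η ^ (j * x).val := by
    intro x
    rw [← pow_mul, ZMod.val_mul]
    exact (pow_mod_orderOf η _).symm.trans (by rw [← hη.eq_orderOf])
  rw [setPoly, map_sum, Finset.sum_union (disjoint_cycClass hn4 hg hab)]
  simp only [map_pow, aeval_X, hx]
  rw [sum_cycClass_mul hn4 hg (fun x => η ^ x.val) hj,
    sum_cycClass_mul hn4 hg (fun x => η ^ x.val) hj, period, period]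

theorem one_mem_cycClass : (1 : ZMod n) ∈ cycClass g 0 := by
  obtain ⟨χ, hχ⟩ := exists_quartic_mulChar hn4 hg
  rw [mem_cycClass_iff hg hχ]
  simp

theorem aeval_Lam (hη : IsPrimitiveRoot η n) {j : ZMod n} {i : ℕ} (hj : j ∈ cycClass g i) :
    aeval (η ^ j.val) (Lam F g) = period η g i + period η g (i + 1) := by
  classical
  have := aeval_setPoly_union (F := F) hn4 hg hη hj (a := 0) (b := 1) (by norm_num)
  rw [add_zero] at this
  rw [← this, Lam]

theorem aeval_Lam_self (hη : IsPrimitiveRoot η n) :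
    aeval η (Lam F g) = period η g 0 + period η g 1 := by
  have : Fact (1 < n) := ⟨(Fact.out : n.Prime).one_lt⟩
  simpa [ZMod.val_one] using aeval_Lam (F := F) hn4 hg hη (one_mem_cycClass hn4 hg)

theorem aeval_Gam_self (hη : IsPrimitiveRoot η n) :
    aeval η (Gam F g) = period η g 1 + period η g 2 := by
  classical
  have : Fact (1 < n) := ⟨(Fact.out : n.Prime).one_lt⟩
  have := aeval_setPoly_union (F := F) hn4 hg hη (one_mem_cycClass hn4 hg) (a := 1) (b := 2)
    (by norm_num)
  simp only [ZMod.val_one, pow_one, zero_add] at this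
  rw [← this, Gam]

/-- The indices of the cyclotomic classes on which `Λ(η^j)` does not vanish. -/
noncomputable def nonvanishing (η : K) (g : (ZMod n)ˣ) : Finset ℕ :=
  open Classical in (Finset.range 4).filter fun i => period η g i + period η g (i + 1) ≠ 0

omit hn4 hg in
theorem mem_nonvanishing {i : ℕ} :
    i ∈ nonvanishing η g ↔ i < 4 ∧ period η g i + period η g (i + 1) ≠ 0 := by
  simp [nonvanishing]

theorem rootPoly_biUnion [DecidableEq (ZMod n)] {T : Finset ℕ} (hT : ∀ i ∈ T, i < 4) :
    rootPoly η (T.biUnion (cycClass g)) = ∏ i ∈ T, Om η g i := by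
  rw [rootPoly, Finset.prod_biUnion]
  · rfl
  · intro i hi j hj hij
    refine disjoint_cycClass hn4 hg fun h => hij ?_
    have := hT i hi
    have := hT j hj
    omega

theorem biUnion_range_four [DecidableEq (ZMod n)] :
    (Finset.range 4).biUnion (cycClass g) = Finset.univ.erase 0 := by
  ext x
  simp only [Finset.mem_biUnion, Finset.mem_range, Finset.mem_erase, Finset.mem_univ, and_true]
  constructor
  · rintro ⟨i, _, hi⟩ rfl
    exact zero_notMem_cycClass i hi
  · exact fun hx => exists_mem_cycClass hn4 hg hx

theorem card_biUnion_cycClass [DecidableEq (ZMod n)] {T : Finset ℕ} (hT : ∀ i ∈ T, i < 4) :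
    (T.biUnion (cycClass g)).card = T.card * ((n - 1) / 4) := by
  rw [Finset.card_biUnion, Finset.sum_congr rfl fun i _ => card_cycClass hn4 hg i]
  · simp
  · intro i hi j hj hij
    refine disjoint_cycClass hn4 hg fun h => hij ?_
    have := hT i hi
    have := hT j hj
    omega

open Classical in
theorem exists_isReducedFraction_cycSeq (hη : IsPrimitiveRoot η n)
    (h0 : (((n - 1) / 4 : ℕ) : F) = 0) :
    ∃ m h l, IsReducedFraction n (cycSeq F g) m h l ∧
      m.map (algebraMap F K) = rootPoly η ((nonvanishing η g).biUnion (cycClass g)) := by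
  have hn : 0 < n := (Fact.out : n.Prime).pos
  obtain ⟨m, h, l, H⟩ := exists_isReducedFraction hn (cycSeq F g)
  refine ⟨m, h, l, H, ?_⟩
  rw [H.map_eq_rootPoly hη, sum_cycSeq]
  congr 1
  ext j
  simp only [Finset.mem_filter, Finset.mem_univ, true_and, Finset.mem_biUnion, mem_nonvanishing]
  by_cases hj : j = 0
  -- The root 1 is never a root of m: Λ(1) = 2·(n-1)/4, which is 0 in F.
  · subst hj
    simp only [zero_notMem_cycClass, and_false, exists_false, iff_false, not_not]
    rw [ZMod.val_zero, pow_zero, Lam, setPoly, map_sum,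
      Finset.sum_union (disjoint_cycClass hn4 hg (by norm_num))]
    simp only [map_pow, aeval_X, one_pow, Finset.sum_const, card_cycClass hn4 hg, nsmul_one]
    rw [← map_natCast (algebraMap F K), h0, map_zero, add_zero]
  · obtain ⟨i, hi, hji⟩ := exists_mem_cycClass hn4 hg hj
    rw [aeval_Lam hn4 hg hη hji]
    constructor
    · exact fun h => ⟨i, ⟨hi, h⟩, hji⟩
    · rintro ⟨i', ⟨hi', h⟩, hji'⟩
      have := mod_eq_of_mem_cycClass hn4 hg hji hji'
      obtain rfl : i = i' := by omega
      exact h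

end CycSeq

/-! ### The three shapes of the minimal polynomial -/

section Cases

variable {F K : Type*} [Field F] [Field K] [Algebra F K] {n : ℕ} [Fact n.Prime] {η : K}
  {g : (ZMod n)ˣ} (hn4 : n % 4 = 1) (hg : ∀ x : (ZMod n)ˣ, x ∈ Subgroup.zpowers g)

include hn4 hg

theorem natDegree_of_map_eq [DecidableEq (ZMod n)] {m : F[X]}
    (hm : m.map (algebraMap F K) = rootPoly η ((nonvanishing η g).biUnion (cycClass g))) :
    m.natDegree = (nonvanishing η g).card * ((n - 1) / 4) := by
  rw [← natDegree_map (algebraMap F K), hm, natDegree_rootPoly,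
    card_biUnion_cycClass hn4 hg fun i hi => (mem_nonvanishing.1 hi).1]

theorem repetition_case (hη : IsPrimitiveRoot η n) (h0 : (((n - 1) / 4 : ℕ) : F) = 0)
    (hnF : (n : F) ≠ 0) (hall : ∀ i < 4, period η g i + period η g (i + 1) ≠ 0) :
    linearSpan (cycSeq F g) = ((n - 1 : ℕ) : ℕ∞) ∧
      IsMinimalPoly (cycSeq F g) ((X ^ n - 1) / (X - 1)) ∧
      IsGeneratorPoly (seqCode n (cycSeq F g)) ((X ^ n - 1) / (X - 1)) ∧
      HasParameters (seqCode n (cycSeq F g)) 1 n := by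
  classical
  have hn : 0 < n := (Fact.out : n.Prime).pos
  obtain ⟨m, h, l, H, hm⟩ := exists_isReducedFraction_cycSeq (F := F) hn4 hg hη h0
  have hT : nonvanishing η g = Finset.range 4 := by
    ext i
    rw [mem_nonvanishing, Finset.mem_range]
    exact ⟨fun h => h.1, fun h => ⟨h, hall i h⟩⟩
  have hdeg := natDegree_of_map_eq hn4 hg hm
  rw [hT, Finset.card_range] at hdeg
  rw [hT, biUnion_range_four hn4 hg] at hm
  have hmX : (X - 1) * m = X ^ n - 1 := by
    apply map_injective (algebraMap F K) (algebraMap F K).injective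
    simp only [Polynomial.map_mul, Polynomial.map_sub, map_X, Polynomial.map_one,
      Polynomial.map_pow, hm]
    exact rootPoly_erase_zero_mul hη
  have hX : (X - 1 : F[X]) ≠ 0 := X_sub_C_ne_zero 1
  have hdiv : ((X : F[X]) ^ n - 1) / (X - 1) = m := by
    rw [← hmX, mul_div_cancel_left₀ _ hX]
  rw [hdiv]
  have hG := H.isGeneratorPoly hn
  refine ⟨?_, H.isMinimalPoly hn cycSeq_add, hG, ?_⟩
  · rw [H.linearSpan_eq hn cycSeq_add, hdeg]
    congr 1
    omega
  · rw [hG.2.2]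
    exact hasParameters_repetition hη H.monic hm hG.2.1 hnF

theorem disjoint_splitting {a b : ℕ} (hab : a % 2 ≠ b % 2) :
    Disjoint (cycClass g a ∪ cycClass g b) (cycClass g (2 + a) ∪ cycClass g (2 + b)) := by
  rw [Finset.disjoint_union_left, Finset.disjoint_union_right, Finset.disjoint_union_right]
  refine ⟨⟨?_, ?_⟩, ?_, ?_⟩ <;> exact disjoint_cycClass hn4 hg (by omega)

theorem union_splitting {a b : ℕ} (hab : a % 2 ≠ b % 2) :
    cycClass g a ∪ cycClass g b ∪ (cycClass g (2 + a) ∪ cycClass g (2 + b)) =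
      Finset.univ.erase 0 := by
  ext x
  simp only [Finset.mem_union, Finset.mem_erase, Finset.mem_univ, and_true]
  constructor
  · rintro h rfl
    simp only [zero_notMem_cycClass, or_self] at h
  · intro hx
    obtain ⟨i, hi, hxi⟩ := exists_mem_cycClass hn4 hg hx
    rcases (show i % 4 = a % 4 ∨ i % 4 = b % 4 ∨ i % 4 = (2 + a) % 4 ∨ i % 4 = (2 + b) % 4 by
      omega) with h | h | h | h
    · exact Or.inl (Or.inl (cycClass_congr hn4 hg h ▸ hxi))
    · exact Or.inl (Or.inr (cycClass_congr hn4 hg h ▸ hxi))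
    · exact Or.inr (Or.inl (cycClass_congr hn4 hg h ▸ hxi))
    · exact Or.inr (Or.inr (cycClass_congr hn4 hg h ▸ hxi))

theorem sq_mem_cycClass : ((g ^ 2 : (ZMod n)ˣ) : ZMod n) ∈ cycClass g 2 := by
  obtain ⟨χ, hχ⟩ := exists_quartic_mulChar hn4 hg
  rw [mem_cycClass_iff hg hχ]
  push_cast
  rw [map_pow, hχ]

theorem Om_mul_Om {a b : ℕ} (hab : a % 4 ≠ b % 4) :
    Om η g a * Om η g b = rootPoly η (cycClass g a ∪ cycClass g b) :=
  (rootPoly_union_of_disjoint η (disjoint_cycClass hn4 hg hab)).symm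

theorem image_sq_mul (a b : ℕ) :
    (cycClass g a ∪ cycClass g b).image (fun x => ((g ^ 2 : (ZMod n)ˣ) : ZMod n) * x) =
      cycClass g (2 + a) ∪ cycClass g (2 + b) := by
  rw [Finset.image_union, image_mul_cycClass hn4 hg (sq_mem_cycClass hn4 hg),
    image_mul_cycClass hn4 hg (sq_mem_cycClass hn4 hg)]

theorem image_sq_mul' (a b : ℕ) :
    (cycClass g (2 + a) ∪ cycClass g (2 + b)).image
      (fun x => ((g ^ 2 : (ZMod n)ˣ) : ZMod n) * x) = cycClass g a ∪ cycClass g b := by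
  rw [image_sq_mul hn4 hg, cycClass_congr hn4 hg (show (2 + (2 + a)) % 4 = a % 4 by omega),
    cycClass_congr hn4 hg (show (2 + (2 + b)) % 4 = b % 4 by omega)]

theorem mul_mem_union {x : ZMod n} (hx : x ∈ cycClass g 0) {a b : ℕ} {y : ZMod n}
    (hy : y ∈ cycClass g a ∪ cycClass g b) : x * y ∈ cycClass g a ∪ cycClass g b := by
  rcases Finset.mem_union.1 hy with h | h
  · exact Finset.mem_union_left _ (zero_add a ▸ mul_mem_cycClass hn4 hg hx h)
  · exact Finset.mem_union_right _ (zero_add b ▸ mul_mem_cycClass hn4 hg hx h)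

theorem isDuadic_of_map_eq [Fintype F] {D : Submodule F (Fin n → F)} {m : F[X]}
    (hD : IsGeneratorPoly D m) {a b : ℕ} (hab : a % 2 ≠ b % 2)
    (hm : m.map (algebraMap F K) = Om η g a * Om η g b)
    (hq : ((Fintype.card F : ℕ) : ZMod n) ∈ cycClass g 0) : IsDuadic η D :=
  ⟨_, _, disjoint_splitting hn4 hg hab, union_splitting hn4 hg hab,
    fun _ => mul_mem_union hn4 hg hq, fun _ => mul_mem_union hn4 hg hq,
    ⟨g ^ 2, image_sq_mul hn4 hg a b, image_sq_mul' hn4 hg a b⟩,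
    m, hD, hm.trans (Om_mul_Om hn4 hg fun h => hab (by omega))⟩

theorem exists_isMinOddLikeWeight_of_map_eq (hη : IsPrimitiveRoot η n)
    {D : Submodule F (Fin n → F)} {m : F[X]} (hD : IsGeneratorPoly D m) {a b : ℕ}
    (hab : a % 2 ≠ b % 2) (hm : m.map (algebraMap F K) = Om η g a * Om η g b)
    (hnF : (n : F) ≠ 0) : ∃ d : ℕ, IsMinOddLikeWeight D d ∧ √(n : ℝ) ≤ d := by
  rw [Om_mul_Om hn4 hg fun h => hab (by omega)] at hm
  rw [hD.2.2]
  refine exists_isMinOddLikeWeight hη hm hD.2.1 hnF (union_splitting hn4 hg hab) (a := g ^ 2) ?_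
  intro x hx
  rw [← image_sq_mul' hn4 hg a b]
  exact Finset.mem_image_of_mem _ hx

theorem two_class_case [Fintype F] (hη : IsPrimitiveRoot η n)
    (h0 : (((n - 1) / 4 : ℕ) : F) = 0) (hnF : (n : F) ≠ 0)
    (hL : aeval η (Lam F g) = 0 ∨ aeval η (Lam F g) = -1)
    (hG : aeval η (Gam F g) = 0 ∨ aeval η (Gam F g) = -1)
    (hq : ((Fintype.card F : ℕ) : ZMod n) ∈ cycClass g 0) :
    linearSpan (cycSeq F g) = (((n - 1) / 2 : ℕ) : ℕ∞) ∧
      (∃ m : F[X], IsMinimalPoly (cycSeq F g) m ∧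
          IsGeneratorPoly (seqCode n (cycSeq F g)) m ∧
          (aeval η (Lam F g) = 0 → aeval η (Gam F g) = 0 →
            m.map (algebraMap F K) = Om η g 2 * Om η g 3) ∧
          (aeval η (Lam F g) = 0 → aeval η (Gam F g) = -1 →
            m.map (algebraMap F K) = Om η g 1 * Om η g 2) ∧
          (aeval η (Lam F g) = -1 → aeval η (Gam F g) = 0 →
            m.map (algebraMap F K) = Om η g 0 * Om η g 3) ∧
          (aeval η (Lam F g) = -1 → aeval η (Gam F g) = -1 →
            m.map (algebraMap F K) = Om η g 0 * Om η g 1)) ∧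
      (∃ d : ℕ, HasParameters (seqCode n (cycSeq F g)) ((n + 1) / 2) d) ∧
      IsDuadic η (seqCode n (cycSeq F g)) ∧
      (∃ d : ℕ, IsMinOddLikeWeight (seqCode n (cycSeq F g)) d ∧ √(n : ℝ) ≤ d) := by
  classical
  have hn : 0 < n := (Fact.out : n.Prime).pos
  obtain ⟨m, h, l, H, hm⟩ := exists_isReducedFraction_cycSeq (F := F) hn4 hg hη h0
  have hdeg := natDegree_of_map_eq hn4 hg hm
  rw [rootPoly_biUnion hn4 hg fun i hi => (mem_nonvanishing.1 hi).1] at hm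
  have hsum := sum_period hn4 hg hη
  have h4 := period_congr (η := η) hn4 hg (show 4 % 4 = 0 % 4 by norm_num)
  rw [aeval_Lam_self hn4 hg hη] at hL ⊢
  rw [aeval_Gam_self hn4 hg hη] at hG ⊢
  have h2 : period η g 2 + period η g 3 = -1 - (period η g 0 + period η g 1) := by
    linear_combination hsum
  have h3 : period η g 3 + period η g 4 = -1 - (period η g 1 + period η g 2) := by
    rw [h4]; linear_combination hsum
  have key : ∀ T : Finset ℕ, T ⊆ Finset.range 4 →
      (∀ i < 4, period η g i + period η g (i + 1) ≠ 0 ↔ i ∈ T) → nonvanishing η g = T := by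
    intro T hT h
    ext i
    rw [mem_nonvanishing]
    exact ⟨fun hi => (h i hi.1).1 hi.2,
      fun hi => have := Finset.mem_range.1 (hT hi); ⟨this, (h i this).2 hi⟩⟩
  have k00 : period η g 0 + period η g 1 = 0 → period η g 1 + period η g 2 = 0 →
      nonvanishing η g = {2, 3} := fun hl hg => key _ (by decide) fun i hi => by
    interval_cases i <;> simp [hl, hg, h2, h3]
  have k01 : period η g 0 + period η g 1 = 0 → period η g 1 + period η g 2 = -1 →
      nonvanishing η g = {1, 2} := fun hl hg => key _ (by decide) fun i hi => by
    interval_cases i <;> simp [hl, hg, h2, h3]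
  have k10 : period η g 0 + period η g 1 = -1 → period η g 1 + period η g 2 = 0 →
      nonvanishing η g = {0, 3} := fun hl hg => key _ (by decide) fun i hi => by
    interval_cases i <;> simp [hl, hg, h2, h3]
  have k11 : period η g 0 + period η g 1 = -1 → period η g 1 + period η g 2 = -1 →
      nonvanishing η g = {0, 1} := fun hl hg => key _ (by decide) fun i hi => by
    interval_cases i <;> simp [hl, hg, h2, h3]
  -- Exactly one of A, -1-A and exactly one of B, -1-B is nonzero, so one even and one odd class
  -- survive. Multiplication by g² exchanges such a pair with its complement.
  obtain ⟨a, b, hab, hT⟩ : ∃ a b : ℕ, a % 2 ≠ b % 2 ∧ nonvanishing η g = {a, b} := by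
    rcases hL with hL | hL <;> rcases hG with hG | hG
    · exact ⟨2, 3, by norm_num, k00 hL hG⟩
    · exact ⟨1, 2, by norm_num, k01 hL hG⟩
    · exact ⟨0, 3, by norm_num, k10 hL hG⟩
    · exact ⟨0, 1, by norm_num, k11 hL hG⟩
  have hane : a ≠ b := fun h => hab (by rw [h])
  have hmab : m.map (algebraMap F K) = Om η g a * Om η g b := by
    rw [hm, hT, Finset.prod_pair hane]
  rw [hT, Finset.card_pair hane] at hdeg
  have hgen := H.isGeneratorPoly hn
  refine ⟨?_, ⟨m, H.isMinimalPoly hn cycSeq_add, hgen, ?_, ?_, ?_, ?_⟩, ?_, ?_, ?_⟩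
  · rw [H.linearSpan_eq hn cycSeq_add, hdeg]
    congr 1
    omega
  · intro hl hg
    rw [hm, k00 hl hg, Finset.prod_pair (by norm_num)]
  · intro hl hg
    rw [hm, k01 hl hg, Finset.prod_pair (by norm_num)]
  · intro hl hg
    rw [hm, k10 hl hg, Finset.prod_pair (by norm_num)]
  · intro hl hg
    rw [hm, k11 hl hg, Finset.prod_pair (by norm_num)]
  · refine exists_hasParameters ?_ (by omega)
    rw [hgen.2.2, finrank_cyclicCode hn H.monic hgen.2.1, hdeg]
    omega
  · exact isDuadic_of_map_eq hn4 hg hgen hab hmab hq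
  · exact exists_isMinOddLikeWeight_of_map_eq hn4 hg hη hgen hab hmab hnF

theorem three_class_case [Fintype F] (hη : IsPrimitiveRoot η n)
    (h0 : (((n - 1) / 4 : ℕ) : F) = 0) (hnF : (n : F) ≠ 0) (hn5 : 5 < n) {j : ℕ} (hj : j < 4)
    (hL : ∀ i < 4, period η g i + period η g (i + 1) = 0 ↔ i = j) :
    linearSpan (cycSeq F g) = ((3 * (n - 1) / 4 : ℕ) : ℕ∞) ∧
      (∃ m : F[X], IsMinimalPoly (cycSeq F g) m ∧
        IsGeneratorPoly (seqCode n (cycSeq F g)) m ∧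
        m.map (algebraMap F K) = (X ^ n - 1) / ((X - 1) * Om η g j)) ∧
      (∃ d : ℕ, HasParameters (seqCode n (cycSeq F g)) ((n + 3) / 4) d ∧
        (orderOf ((Fintype.card F : ℕ) : ZMod n) = (n - 1) / 4 →
          ∀ r N : ℝ, r = ((Fintype.card F : ℕ) : ℝ) ^ ((n - 1) / 4) → N = (r - 1) / n →
            ((((Fintype.card F : ℕ) : ℝ) - 1) * (r - 1) - 1) / ((Fintype.card F : ℕ) * N)
                - (((Fintype.card F : ℕ) : ℝ) - 1) / (Fintype.card F : ℕ) *
                  ((N - 1) * √r / N) ≤ d ∧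
            ⌊((((Fintype.card F : ℕ) : ℝ) - 1) * (r - 1) - 1) / ((Fintype.card F : ℕ) * N)
                - (((Fintype.card F : ℕ) : ℝ) - 1) / (Fintype.card F : ℕ) *
                  ⌊(N - 1) * √r / N⌋⌋ ≤ (d : ℤ))) := by
  classical
  have hn : 0 < n := (Fact.out : n.Prime).pos
  obtain ⟨m, h, l, H, hm⟩ := exists_isReducedFraction_cycSeq (F := F) hn4 hg hη h0
  have hdeg := natDegree_of_map_eq hn4 hg hm
  have hT : nonvanishing η g = (Finset.range 4).erase j := by
    ext i
    rw [mem_nonvanishing, Finset.mem_erase, Finset.mem_range, and_comm, and_congr_left_iff]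
    exact fun hi => not_congr (hL i hi)
  rw [hT, Finset.card_erase_of_mem (Finset.mem_range.2 hj), Finset.card_range] at hdeg
  have hgen := H.isGeneratorPoly hn
  have hrank : Module.finrank F (cyclicCode n m) = (n - 1) / 4 + 1 := by
    rw [finrank_cyclicCode hn H.monic hgen.2.1, hdeg]
    omega
  refine ⟨?_, ⟨m, H.isMinimalPoly hn cycSeq_add, hgen, ?_⟩, ?_⟩
  · rw [H.linearSpan_eq hn cycSeq_add, hdeg]
    congr 1
    omega
  · have hprod : (X - 1) * Om η g j * m.map (algebraMap F K) = X ^ n - 1 := by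
      rw [hm, hT, rootPoly_biUnion hn4 hg fun i hi => Finset.mem_range.1 (Finset.mem_of_mem_erase hi),
        mul_assoc, Finset.mul_prod_erase _ _ (Finset.mem_range.2 hj),
        ← rootPoly_biUnion hn4 hg fun i hi => Finset.mem_range.1 hi, biUnion_range_four hn4 hg]
      exact rootPoly_erase_zero_mul hη
    have hne : (X - 1) * Om η g j ≠ 0 :=
      left_ne_zero_of_mul (hprod ▸ X_pow_sub_one_ne_zero hn.ne')
    rw [← hprod, mul_div_cancel_left₀ _ hne]
  · have hk : (n + 3) / 4 = (n - 1) / 4 + 1 := by omega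
    rw [hgen.2.2, hk]
    obtain ⟨d, hd⟩ := exists_hasParameters hrank (by omega)
    refine ⟨d, hd, ?_⟩
    rintro hord r N rfl hNr
    obtain ⟨c, hc, hc0, hcd⟩ := hd.2.1
    -- If q ≡ 1 mod n, its order would be 1, but (n-1)/4 > 1 because n > 5.
    have hqn : ¬ n ∣ Fintype.card F - 1 := by
      intro hdvd
      have : ((Fintype.card F : ℕ) : ZMod n) = 1 := by
        have h1 := (ZMod.natCast_eq_zero_iff _ _).2 hdvd
        rw [Nat.cast_sub Fintype.card_pos, Nat.cast_one, sub_eq_zero] at h1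
        exact h1
      rw [this, orderOf_one] at hord
      omega
    have hdvd : n ∣ Fintype.card F ^ ((n - 1) / 4) - 1 := by
      rw [← ZMod.natCast_eq_zero_iff, Nat.cast_sub (Nat.one_le_pow _ _ Fintype.card_pos),
        Nat.cast_pow, ← hord, pow_orderOf_eq_one, Nat.cast_one, sub_self]
    obtain ⟨M, hM⟩ := hdvd
    have hgt : 1 < Fintype.card F ^ ((n - 1) / 4) :=
      Nat.one_lt_pow (by omega) Fintype.one_lt_card
    have hM1 : Fintype.card F ^ ((n - 1) / 4) = n * M + 1 := by omega
    have hM0 : M ≠ 0 := by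
      rintro rfl
      omega
    have hNM : N = M := by
      have hr : ((Fintype.card F : ℕ) : ℝ) ^ ((n - 1) / 4) = n * M + 1 := by exact_mod_cast hM1
      have hnR : (n : ℝ) ≠ 0 := by exact_mod_cast hn.ne'
      rw [hNr, hr, add_sub_cancel_right, mul_div_cancel_left₀ _ hnR]
    have h0S : (0 : ZMod n) ∉ (nonvanishing η g).biUnion (cycClass g) := by
      simp [zero_notMem_cycClass]
    have hb := cyclicCode_weight_bound hη hm hgen.2.1 h0S hnF hqn hrank hM1 hM0 hc hc0
    have hw : hammingNorm c = d := by rw [← hcd]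
    rw [hw, ← hNM] at hb
    refine ⟨hb, floor_sub_mul_floor_le ?_ ?_ (by exact_mod_cast hb)⟩
    all_goals have hq1 : (1 : ℝ) < (Fintype.card F : ℕ) := by exact_mod_cast Fintype.one_lt_card
    · exact div_nonneg (by linarith) (by linarith)
    · rw [div_lt_one (by linarith)]
      linarith

end Cases
end CycCode
-- Specialising the period relations to characteristic p
theorem mainTheorem1 {F K : Type*} [Field F] [Fintype F] [Field K] [Algebra F K]
    (p : ℕ) [Fact p.Prime] [CharP F p] (q : ℕ) (hq : Fintype.card F = q)
    (n : ℕ) [Fact n.Prime] (hn4 : n % 4 = 1) (hp : (n - 1) / 4 ≡ 0 [MOD p])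
    (u v : ℤ) (huv : (n : ℤ) = u ^ 2 + 4 * v ^ 2) (hu : u ≡ 1 [ZMOD 4])
    (g : (ZMod n)ˣ) (hg : ∀ x : (ZMod n)ˣ, x ∈ Subgroup.zpowers g)
    (η : K) (hη : IsPrimitiveRoot η n) :
    -- first case
    (n % 8 = 1 →
      (¬ v / 2 ≡ 0 [ZMOD p] →
        linearSpan (cycSeq F g) = ((n - 1 : ℕ) : ℕ∞) ∧
        IsMinimalPoly (cycSeq F g) ((X ^ n - 1) / (X - 1)) ∧
        IsGeneratorPoly (seqCode n (cycSeq F g)) ((X ^ n - 1) / (X - 1)) ∧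
        HasParameters (seqCode n (cycSeq F g)) 1 n) ∧
      (v / 2 ≡ 0 [ZMOD p] → (q : ZMod n) ∈ cycClass g 0 →
        linearSpan (cycSeq F g) = (((n - 1) / 2 : ℕ) : ℕ∞) ∧
        (aeval η (Lam F g) = 0 ∨ aeval η (Lam F g) = -1) ∧
        (aeval η (Gam F g) = 0 ∨ aeval η (Gam F g) = -1) ∧
        (∃ m : F[X], IsMinimalPoly (cycSeq F g) m ∧
          IsGeneratorPoly (seqCode n (cycSeq F g)) m ∧
          (aeval η (Lam F g) = 0 → aeval η (Gam F g) = 0 →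
            m.map (algebraMap F K) = Om η g 2 * Om η g 3) ∧
          (aeval η (Lam F g) = 0 → aeval η (Gam F g) = -1 →
            m.map (algebraMap F K) = Om η g 1 * Om η g 2) ∧
          (aeval η (Lam F g) = -1 → aeval η (Gam F g) = 0 →
            m.map (algebraMap F K) = Om η g 0 * Om η g 3) ∧
          (aeval η (Lam F g) = -1 → aeval η (Gam F g) = -1 →
            m.map (algebraMap F K) = Om η g 0 * Om η g 1)) ∧
        (∃ d : ℕ, HasParameters (seqCode n (cycSeq F g)) ((n + 1) / 2) d) ∧
        IsDuadic η (seqCode n (cycSeq F g)) ∧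
        (∃ d : ℕ, IsMinOddLikeWeight (seqCode n (cycSeq F g)) d ∧ √(n : ℝ) ≤ d))) ∧
    -- second case
    (n % 8 = 5 →
      (¬ (u ^ 2 + 3) / 4 ≡ 0 [ZMOD p] →
        linearSpan (cycSeq F g) = ((n - 1 : ℕ) : ℕ∞) ∧
        IsMinimalPoly (cycSeq F g) ((X ^ n - 1) / (X - 1)) ∧
        IsGeneratorPoly (seqCode n (cycSeq F g)) ((X ^ n - 1) / (X - 1)) ∧
        HasParameters (seqCode n (cycSeq F g)) 1 n) ∧
      ((u ^ 2 + 3) / 4 ≡ 0 [ZMOD p] → (q : ZMod n) ∈ cycClass g 0 →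
        linearSpan (cycSeq F g) = ((3 * (n - 1) / 4 : ℕ) : ℕ∞) ∧
        (aeval η (Lam F g) = 0 ∨ aeval η (Lam F g) = -1 ∨
          aeval η (Gam F g) = 0 ∨ aeval η (Gam F g) = -1) ∧
        (∃ m : F[X], IsMinimalPoly (cycSeq F g) m ∧
          IsGeneratorPoly (seqCode n (cycSeq F g)) m ∧
          (aeval η (Lam F g) = 0 →
            m.map (algebraMap F K) = (X ^ n - 1) / ((X - 1) * Om η g 0)) ∧
          (aeval η (Lam F g) = -1 →
            m.map (algebraMap F K) = (X ^ n - 1) / ((X - 1) * Om η g 2)) ∧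
          (aeval η (Gam F g) = 0 →
            m.map (algebraMap F K) = (X ^ n - 1) / ((X - 1) * Om η g 1)) ∧
          (aeval η (Gam F g) = -1 →
            m.map (algebraMap F K) = (X ^ n - 1) / ((X - 1) * Om η g 3))) ∧
        (∃ d : ℕ, HasParameters (seqCode n (cycSeq F g)) ((n + 3) / 4) d ∧
          (orderOf (q : ZMod n) = (n - 1) / 4 →
            ∀ r N : ℝ, r = (q : ℝ) ^ ((n - 1) / 4) → N = (r - 1) / n →
              (((q : ℝ) - 1) * (r - 1) - 1) / (q * N)
                  - ((q : ℝ) - 1) / q * ((N - 1) * √r / N) ≤ d ∧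
              ⌊(((q : ℝ) - 1) * (r - 1) - 1) / (q * N)
                  - ((q : ℝ) - 1) / q * ⌊(N - 1) * √r / N⌋⌋ ≤ (d : ℤ))))) := by
  classical
  subst hq
  have hnp : n.Prime := Fact.out
  have h0 : (((n - 1) / 4 : ℕ) : F) = 0 :=
    (CharP.cast_eq_zero_iff F p _).2 ((Nat.modEq_zero_iff_dvd).1 hp)
  have h0K : (((n - 1) / 4 : ℕ) : K) = 0 := by
    rw [← map_natCast (algebraMap F K), h0, map_zero]
  have hnF : (n : F) = 1 := by
    have : n = 4 * ((n - 1) / 4) + 1 := by omega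
    rw [this, Nat.cast_add, Nat.cast_mul, h0, mul_zero, zero_add, Nat.cast_one]
  have hnF0 : (n : F) ≠ 0 := by rw [hnF]; exact one_ne_zero
  have hnK : (n : K) = 1 := by rw [← map_natCast (algebraMap F K), hnF, map_one]
  have : CharP K p := charP_of_injective_algebraMap (algebraMap F K).injective p
  have hzero : ∀ z : ℤ, (z : K) = 0 ↔ z ≡ 0 [ZMOD p] := fun z => by
    rw [CharP.intCast_eq_zero_iff K p, Int.modEq_zero_iff_dvd]
  have hpp : p.Prime := Fact.out
  have hpdvd : p ∣ (n - 1) / 4 := (Nat.modEq_zero_iff_dvd).1 hp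
  have hn5 : 5 < n := by
    have h1 := hnp.one_lt
    by_contra hle
    have : n = 5 := by omega
    subst this
    exact hpp.one_lt.not_ge (Nat.le_of_dvd (by norm_num) hpdvd)
  have hsum := sum_period hn4 hg hη
  have h4 := period_congr (η := η) hn4 hg (show 4 % 4 = 0 % 4 by norm_num)
  have hL := aeval_Lam_self (F := F) hn4 hg hη
  have hG := aeval_Gam_self (F := F) hn4 hg hη
  have h2 : period η g 2 + period η g 3 = -1 - (period η g 0 + period η g 1) := by
    linear_combination hsum
  have h3 : period η g 3 + period η g 4 = -1 - (period η g 1 + period η g 2) := by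
    rw [h4]; linear_combination hsum
  -- The map x ↦ x²+x is invariant under x ↦ -1-x, so two conditions control all four values of Λ.
  have hall : (period η g 0 + period η g 1) ^ 2 + (period η g 0 + period η g 1) ≠ 0 →
      (period η g 1 + period η g 2) ^ 2 + (period η g 1 + period η g 2) ≠ 0 →
      ∀ i < 4, period η g i + period η g (i + 1) ≠ 0 := by
    intro hA hB i hi hz
    interval_cases i
    · exact hA (by rw [hz]; ring)
    · exact hB (by rw [hz]; ring)
    · exact hA (by linear_combination (period η g 0 + period η g 1) * (hz.symm.trans h2))
    · exact hB (by linear_combination (period η g 1 + period η g 2) * (hz.symm.trans h3))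
  have hor : ∀ x : K, x ^ 2 + x = 0 → x = 0 ∨ x = -1 := fun x hx => by
    rcases mul_eq_zero.1 (show x * (x + 1) = 0 by linear_combination hx) with h | h
    · exact Or.inl h
    · exact Or.inr (eq_neg_of_add_eq_zero_left h)
  constructor
  · intro hn8
    obtain ⟨s, hs, hR, hA, hB⟩ := quartic_periods_of_mod_eight_eq_one hn4 hg hn8 huv hη
    rw [h0K] at hA hB
    have hs0 : (s : K) ≠ 0 := by rcases hs with rfl | rfl <;> simp
    have hR0 : period η g 0 - period η g 1 + period η g 2 - period η g 3 ≠ 0 := by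
      intro h
      rw [h, hnK] at hR
      simp at hR
    constructor
    · intro hv
      rw [← hzero] at hv
      refine repetition_case hn4 hg hη h0 hnF0 (hall ?_ ?_)
      · rw [hA, zero_add]
        exact mul_ne_zero (mul_ne_zero hs0 hv) hR0
      · rw [hB, zero_sub]
        exact neg_ne_zero.2 (mul_ne_zero (mul_ne_zero hs0 hv) hR0)
    · intro hv hq
      rw [← hzero] at hv
      rw [hv, mul_zero, zero_mul, add_zero] at hA
      rw [hv, mul_zero, zero_mul, sub_zero] at hB
      have hL' := hor _ hA
      have hG' := hor _ hB
      rw [← hL] at hL'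
      rw [← hG] at hG'
      obtain ⟨c1, c2⟩ := two_class_case hn4 hg hη h0 hnF0 hL' hG' hq
      exact ⟨c1, hL', hG', c2⟩
  · intro hn8
    obtain ⟨s, hs, hR, hA, hB⟩ := quartic_periods_of_mod_eight_eq_five hn4 hg hn8 huv hη
    rw [hnK] at hA hB hR
    -- For n ≡ 5 mod 8, (n-1)/4 is odd, so p is odd and one may divide by 2 in K.
    have hp2 : (2 : K) ≠ 0 := by
      intro h
      have : p ∣ 2 := (CharP.cast_eq_zero_iff K p 2).1 (by exact_mod_cast h)
      rw [(Nat.prime_dvd_prime_iff_eq hpp Nat.prime_two).1 this] at hpdvd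
      omega
    have hp4 : (4 : K) ≠ 0 := by
      have : (4 : K) = 2 * 2 := by norm_num
      rw [this]
      exact mul_ne_zero hp2 hp2
    have hs2 : (s : K) ^ 2 = 1 := by rcases hs with rfl | rfl <;> simp
    have hA' : 2 * ((period η g 0 + period η g 1) ^ 2 + (period η g 0 + period η g 1)) = -1 +
        s * v * (period η g 0 - period η g 1 + period η g 2 - period η g 3) := by
      refine mul_left_cancel₀ hp2 ?_
      linear_combination hA + (1 + 3 * (period η g 0 + period η g 1) -
            (period η g 2 + period η g 3)) * hsum
    have hB' : 2 * ((period η g 1 + period η g 2) ^ 2 + (period η g 1 + period η g 2)) = -1 -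
        s * v * (period η g 0 - period η g 1 + period η g 2 - period η g 3) := by
      refine mul_left_cancel₀ hp2 ?_
      linear_combination hB + (1 + 3 * (period η g 1 + period η g 2) -
            (period η g 3 + period η g 0)) * hsum
    have hodd : (u ^ 2 + 3) = 4 * ((u ^ 2 + 3) / 4) := by
      obtain ⟨t, ht⟩ := hu.symm.dvd
      have : u ^ 2 + 3 = 4 * (4 * t ^ 2 + 2 * t + 1) := by
        have : u = 4 * t + 1 := by linarith
        rw [this]; ring
      rw [this]
      omega
    have huK : (u : K) ^ 2 + 3 = 4 * (((u ^ 2 + 3) / 4 : ℤ) : K) := by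
      have := congrArg (Int.cast (R := K)) hodd
      push_cast at this
      exact this
    have huvK : (1 : K) = u ^ 2 + 4 * v ^ 2 := by
      rw [← hnK]
      exact_mod_cast congrArg (Int.cast (R := K)) huv
    -- With R² = s² = 1 the product of -1+svR and -1-svR is 1-v², and 1 = u²+4v² in K turns 4(1-v²)
    -- into u²+3.
    have hprod : 4 * (((period η g 0 + period η g 1) ^ 2 + (period η g 0 + period η g 1)) *
        ((period η g 1 + period η g 2) ^ 2 + (period η g 1 + period η g 2))) =
        (((u ^ 2 + 3) / 4 : ℤ) : K) := by
      refine mul_left_cancel₀ hp4 ?_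
      rw [← huK]
      have e : (2 * ((period η g 0 + period η g 1) ^ 2 + (period η g 0 + period η g 1))) *
        (2 * ((period η g 1 + period η g 2) ^ 2 + (period η g 1 + period η g 2))) =
          1 - v ^ 2 := by
        rw [hA', hB']
        linear_combination (-(s : K) ^ 2 * v ^ 2) * hR - v ^ 2 * hs2
      linear_combination 4 * e + huvK
    have hsumAB : ((period η g 0 + period η g 1) ^ 2 + (period η g 0 + period η g 1)) +
        ((period η g 1 + period η g 2) ^ 2 + (period η g 1 + period η g 2)) = -1 :=
      mul_left_cancel₀ hp2 (by linear_combination hA' + hB')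
    constructor
    · intro hu3
      rw [← hzero, ← hprod] at hu3
      have h' := right_ne_zero_of_mul hu3
      exact repetition_case hn4 hg hη h0 hnF0
        (hall (left_ne_zero_of_mul h') (right_ne_zero_of_mul h'))
    · intro hu3 _
      rw [← hzero, ← hprod] at hu3
      have hne : (-1 : K) ≠ 0 := neg_ne_zero.2 one_ne_zero
      -- One of A²+A, B²+B is 0 and the other is then -1 ≠ 0; so exactly one of A, B, -1-A, -1-B
      -- vanishes, since 0 and -1 differ.
      obtain ⟨j, hj, hjL⟩ : ∃ j < 4, ∀ i < 4, period η g i + period η g (i + 1) = 0 ↔ i = j := by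
        rcases mul_eq_zero.1 ((mul_eq_zero.1 hu3).resolve_left hp4) with hz | hz
        · rw [hz, zero_add] at hsumAB
          have h1 : period η g 1 + period η g 2 ≠ 0 := fun h => hne (by
            rw [← hsumAB, h]; ring)
          have h1' : -1 - (period η g 1 + period η g 2) ≠ 0 := fun h => hne (by
            rw [← hsumAB]; linear_combination (-(period η g 1 + period η g 2)) * h)
          rcases hor _ hz with h | h
          · refine ⟨0, by norm_num, fun i hi => ?_⟩
            interval_cases i <;> simp [h, h1, h2, h3, h1']
          · refine ⟨2, by norm_num, fun i hi => ?_⟩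
            interval_cases i <;> simp [h, h1, h2, h3, h1']
        · rw [hz, add_zero] at hsumAB
          have h1 : period η g 0 + period η g 1 ≠ 0 := fun h => hne (by
            rw [← hsumAB, h]; ring)
          have h1' : -1 - (period η g 0 + period η g 1) ≠ 0 := fun h => hne (by
            rw [← hsumAB]; linear_combination (-(period η g 0 + period η g 1)) * h)
          rcases hor _ hz with h | h
          · refine ⟨1, by norm_num, fun i hi => ?_⟩
            interval_cases i <;> simp [h, h1, h2, h3, h1']
          · refine ⟨3, by norm_num, fun i hi => ?_⟩
            interval_cases i <;> simp [h, h1, h2, h3, h1']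
      obtain ⟨c1, ⟨m, hm1, hm2, hm3⟩, c3⟩ := three_class_case (F := F) hn4 hg hη h0 hnF0 hn5 hj hjL
      rw [hL, hG]
      refine ⟨c1, ?_, ⟨m, hm1, hm2, ?_, ?_, ?_, ?_⟩, c3⟩
      · have := (hjL j hj).2 rfl
        interval_cases j
        · exact Or.inl this
        · exact Or.inr (Or.inr (Or.inl this))
        · exact Or.inr (Or.inl (by linear_combination h2 - this))
        · exact Or.inr (Or.inr (Or.inr (by linear_combination h3 - this)))
      · intro h
        rw [hm3, (hjL 0 (by norm_num)).1 h]
      · intro h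
        rw [hm3, (hjL 2 (by norm_num)).1 (by rw [h2, h]; ring)]
      · intro h
        rw [hm3, (hjL 1 (by norm_num)).1 h]
      · intro h
        rw [hm3, (hjL 3 (by norm_num)).1 (by rw [h3, h]; ring)]
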